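/- Let $\Omega\subset\mathbb{R}^d$ be a bounded open set with $C^2$ boundary and outward unit normal $n$, let $T>0$, and let $\rho,\lambda,\gamma,\tau,k,h>0$ be constants. Put $f(s)=\frac{(s-1)^2s^2}{4h^2}$, let $\eta,\kappa\in C^1(\mathbb{R})$, $\nu\in C^3(\mathbb{R})$, and suppose that $\alpha\le\eta,\kappa,\nu\le\beta$ on $\mathbb{R}$ for some constants $\alpha,\beta>0$. Write $[\nabla u]_{ij}=\partial_ju^i$, and $(\nabla\cdot M)_i=\sum_j\partial_jM_{ij}$ for a matrix field $M$. Let $(u,p,\varphi,F)$ be a smooth solution on $\Omega\times(0,T)$ of $$\rho(\partial_tu+u\cdot\nabla u)+\nabla p-\nabla\cdot(\eta(\varphi)\nabla u)=-\lambda\nabla\cdot(\nabla\varphi\otimes\nabla\varphi)+\nabla\cdot\big(\nu(\varphi)(FF^T-I)\big)-\frac{\eta(\varphi)(1-\varphi)u}{\kappa(\varphi)},\qquad\nabla\cdot u=0,$$ $$\partial_tF-k\big(\nu(\varphi)\Delta F+2\nabla\nu(\varphi)\cdot\nabla F\big)+u\cdot\nabla F=\nabla u\,F,\qquad\partial_t\varphi+u\cdot\nabla\varphi=\tau\Delta\mu,$$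 $$\mu=-\lambda\Delta\varphi+\lambda\gamma f'(\varphi)+\tfrac12\nu'(\varphi)\,\mathrm{tr}(FF^T-I),$$ with $u=0$ and $\partial_n\mu=\partial_n\varphi=\partial_nF^{ij}=\partial_n\Delta F^{ij}=0$ on $\partial\Omega\times(0,T)$ for all $i,j$. Here "smooth" means: at the times $0<t<T$ the fields extend across $\partial\Omega$ to functions of class $C^2$ ($u$), $C^4$ ($\varphi$), $C^3$ ($F$) jointly in $(t,x)$ and $C^1$ in $x$ ($p$), and $u,\varphi,\nabla\varphi,F$ are continuous on $[0,T]\times\overline\Omega$. Define the total energy $$E(t)=\int_\Omega\rho|u|^2+\lambda|\nabla\varphi|^2+2\lambda\gamma f(\varphi)+\nu(\varphi)\,\mathrm{tr}(FF^T-I)\,dx$$ and $$D(t)=\int_\Omega\big(\eta(\varphi)|\nabla u|^2+\tau|\nabla\mu|^2\big)dx+k\int_\Omega\nu(\varphi)^2\sum_{i,j}|\nabla F^{ij}|^2dx+\int_\Omega\frac{\eta(\varphi)}{\kappa(\varphi)}(1-\varphi)|u|^2dx.$$ Then $E$ is differentiable on $(0,T)$ and $$\frac12\frac{d}{dt}E(t)=-D(t)\qquad(0<t<T).$$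 Moreover $D(t)\ge0$ at every time $t\in(0,T)$ with $\varphi(\cdot,t)\le1$ in $\Omega$; and if $\varphi\le1$ in $\Omega\times(0,T)$, then $E$ is nonincreasing on $[0,T]$. -/

import Mathlib

open Set Filter Topology MeasureTheory
open scoped Matrix

noncomputable section

namespace Thrombus

/-- Euclidean space `ℝ^d`. -/
abbrev Space (d : ℕ) : Type := EuclideanSpace ℝ (Fin d)

/-! ### Domains with a `C²` boundary -/

/-- `r` is a `C²` local defining function of the open set `Ω` at the point `x`: near `x` the set `Ω`
is `{r < 0}`, and `∇ r (x) ≠ 0`. -/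
structure IsLocalDefiningFunction {d : ℕ} (Ω : Set (Space d)) (x : Space d)
    (r : Space d → ℝ) : Prop where
  contDiffAt : ContDiffAt ℝ 2 r x
  gradient_ne_zero : gradient r x ≠ 0
  mem_iff : ∀ᶠ y in 𝓝 x, (y ∈ Ω ↔ r y < 0)

/-- The boundary of `Ω` is of class `C²`, with `Ω` locally on one side of it. -/
def HasC2Boundary {d : ℕ} (Ω : Set (Space d)) : Prop :=
  ∀ x ∈ frontier Ω, ∃ r : Space d → ℝ, IsLocalDefiningFunction Ω x r

/-- `n` is the outward unit normal vector of `Ω` at the boundary point `x`. -/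
def IsOutwardUnitNormal {d : ℕ} (Ω : Set (Space d)) (x n : Space d) : Prop :=
  ∃ r : Space d → ℝ, IsLocalDefiningFunction Ω x r ∧ n = ‖gradient r x‖⁻¹ • gradient r x

/-- The homogeneous Neumann condition `∂ₙ g = 0` on `∂Ω`. -/
def NeumannZero {d : ℕ} (Ω : Set (Space d)) (g : Space d → ℝ) : Prop :=
  ∀ x ∈ frontier Ω, ∀ n : Space d, IsOutwardUnitNormal Ω x n → fderiv ℝ g x n = 0

/-! ### Differential operators -/

/-- The partial derivative `∂ⱼ g`. -/
def pd {d : ℕ} (j : Fin d) (g : Space d → ℝ) (x : Space d) : ℝ :=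
  fderiv ℝ g x (EuclideanSpace.single j 1)

/-- The Laplacian `∑ⱼ ∂ⱼ ∂ⱼ g`. -/
def lap {d : ℕ} (g : Space d → ℝ) (x : Space d) : ℝ :=
  ∑ j, pd j (pd j g) x

/-- The matrix `∇v`, with `[∇v]ᵢⱼ = ∂ⱼ vⁱ`. -/
def jac {d : ℕ} (v : Space d → Space d) (x : Space d) : Matrix (Fin d) (Fin d) ℝ :=
  Matrix.of fun i j => pd j (fun y => v y i) x

/-- The divergence of a vector field. -/
def vdiv {d : ℕ} (v : Space d → Space d) (x : Space d) : ℝ :=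
  ∑ j, pd j (fun y => v y j) x

/-- The `i`-th component of the divergence of a matrix field, `∑ⱼ ∂ⱼ Mᵢⱼ`. -/
def mdiv {d : ℕ} (M : Space d → Matrix (Fin d) (Fin d) ℝ) (i : Fin d) (x : Space d) : ℝ :=
  ∑ j, pd j (fun y => M y i j) x

/-- `v · ∇g = ∑ⱼ vʲ ∂ⱼ g` for a scalar function `g`. -/
def adv {d : ℕ} (v : Space d) (g : Space d → ℝ) (x : Space d) : ℝ :=
  ∑ j, v j * pd j g x

/-! ### The governing system -/

/-- The parameters of the model: the constants `ρ` (mass density), `lam` (the mixing energy density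
`λ`), `γ`, `τ`, `k` (diffusion coefficient of the deformation equation), `h` (interfacial
thickness), and the functions `η` (viscosity), `κ` (permeability), `ν` (viscoelasticity) of the
phase-field variable. -/
structure Params where
  ρ : ℝ
  lam : ℝ
  γ : ℝ
  τ : ℝ
  k : ℝ
  h : ℝ
  η : ℝ → ℝ
  κ : ℝ → ℝ
  ν : ℝ → ℝ

/-- The standing assumptions on the parameters. -/
structure Params.Admissible (P : Params) : Prop where
  ρ_pos : 0 < P.ρ
  lam_pos : 0 < P.lam
  γ_pos : 0 < P.γ
  τ_pos : 0 < P.τ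
  k_pos : 0 < P.k
  h_pos : 0 < P.h
  η_contDiff : ContDiff ℝ 1 P.η
  κ_contDiff : ContDiff ℝ 1 P.κ
  ν_contDiff : ContDiff ℝ 3 P.ν
  bounds : ∃ α β : ℝ, 0 < α ∧ ∀ s : ℝ, P.η s ∈ Icc α β ∧ P.ν s ∈ Icc α β ∧ P.κ s ∈ Icc α β

/-- The double-well potential `f(s) = (s - 1)² s² / (4 h²)`. -/
def Params.f (P : Params) (s : ℝ) : ℝ :=
  (s - 1) ^ 2 * s ^ 2 / (4 * P.h ^ 2)

/-- `F Fᵀ - I`. -/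
def strain {d : ℕ} (A : Matrix (Fin d) (Fin d) ℝ) : Matrix (Fin d) (Fin d) ℝ :=
  A * Aᵀ - 1

/-- The unknowns: velocity `u`, pressure `p`, phase-field variable `φ`, deformation gradient `F`,
as functions of time and position. Only their values on the closed cylinder `[0,T] × closure Ω`
matter; the values elsewhere serve as an extension across the boundary, in order that derivatives
at boundary points make sense. -/
structure Fields (d : ℕ) where
  u : ℝ → Space d → Space d
  p : ℝ → Space d → ℝ
  φ : ℝ → Space d → ℝ
  F : ℝ → Space d → Matrix (Fin d) (Fin d) ℝ

/-- The chemical potential `μ = -λ Δφ + λ γ f'(φ) + (ν'(φ)/2) tr(F Fᵀ - I)`. -/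
def chemPot {d : ℕ} (P : Params) (S : Fields d) (t : ℝ) (x : Space d) : ℝ :=
  -P.lam * lap (S.φ t) x + P.lam * P.γ * deriv P.f (S.φ t x)
    + deriv P.ν (S.φ t x) / 2 * (strain (S.F t x)).trace

/-- The regularity of a smooth (classical) solution: for `0 < t < T` the fields are smooth up to the
boundary of `Ω`, to the order that the equations and the boundary conditions call for, and the
fields that enter the energy are continuous up to the times `0` and `T`. -/
structure IsRegular {d : ℕ} (Ω : Set (Space d)) (T : ℝ) (S : Fields d) : Prop where
  u_smooth : ∀ t ∈ Ioo 0 T, ∀ x ∈ closure Ω,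
    ContDiffAt ℝ 2 (fun z : ℝ × Space d => S.u z.1 z.2) (t, x)
  p_smooth : ∀ t ∈ Ioo 0 T, ∀ x ∈ closure Ω, ContDiffAt ℝ 1 (S.p t) x
  φ_smooth : ∀ t ∈ Ioo 0 T, ∀ x ∈ closure Ω,
    ContDiffAt ℝ 4 (fun z : ℝ × Space d => S.φ z.1 z.2) (t, x)
  F_smooth : ∀ t ∈ Ioo 0 T, ∀ x ∈ closure Ω, ∀ i j : Fin d,
    ContDiffAt ℝ 3 (fun z : ℝ × Space d => S.F z.1 z.2 i j) (t, x)
  u_cont : ContinuousOn (fun z : ℝ × Space d => S.u z.1 z.2) (Icc 0 T ×ˢ closure Ω)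
  φ_cont : ContinuousOn (fun z : ℝ × Space d => S.φ z.1 z.2) (Icc 0 T ×ˢ closure Ω)
  gradφ_cont : ContinuousOn (fun z : ℝ × Space d => gradient (S.φ z.1) z.2)
    (Icc 0 T ×ˢ closure Ω)
  F_cont : ∀ i j : Fin d,
    ContinuousOn (fun z : ℝ × Space d => S.F z.1 z.2 i j) (Icc 0 T ×ˢ closure Ω)

/-- A smooth solution of the governing system on `Ω × (0,T)` with its boundary conditions. -/
structure IsSmoothSolution {d : ℕ} (P : Params) (Ω : Set (Space d)) (T : ℝ) (S : Fields d) :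
    Prop where
  regular : IsRegular Ω T S
  momentum : ∀ t ∈ Ioo 0 T, ∀ x ∈ Ω, ∀ i : Fin d,
    P.ρ * (deriv (fun s => S.u s x i) t + adv (S.u t x) (fun y => S.u t y i) x)
        + pd i (S.p t) x
        - mdiv (fun y => P.η (S.φ t y) • jac (S.u t) y) i x
      = -P.lam * mdiv (fun y => Matrix.of fun a b => pd a (S.φ t) y * pd b (S.φ t) y) i x
        + mdiv (fun y => P.ν (S.φ t y) • strain (S.F t y)) i x
        - P.η (S.φ t x) * (1 - S.φ t x) * S.u t x i / P.κ (S.φ t x)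
  incompressible : ∀ t ∈ Ioo 0 T, ∀ x ∈ Ω, vdiv (S.u t) x = 0
  deformation : ∀ t ∈ Ioo 0 T, ∀ x ∈ Ω, ∀ i j : Fin d,
    deriv (fun s => S.F s x i j) t
        - P.k * (P.ν (S.φ t x) * lap (fun y => S.F t y i j) x
            + 2 * ∑ l, pd l (fun y => P.ν (S.φ t y)) x * pd l (fun y => S.F t y i j) x)
        + adv (S.u t x) (fun y => S.F t y i j) x
      = (jac (S.u t) x * S.F t x) i j
  phase : ∀ t ∈ Ioo 0 T, ∀ x ∈ Ω,
    deriv (fun s => S.φ s x) t + adv (S.u t x) (S.φ t) x = P.τ * lap (chemPot P S t) x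
  u_boundary : ∀ t ∈ Ioo 0 T, ∀ x ∈ frontier Ω, S.u t x = 0
  μ_boundary : ∀ t ∈ Ioo 0 T, NeumannZero Ω (chemPot P S t)
  φ_boundary : ∀ t ∈ Ioo 0 T, NeumannZero Ω (S.φ t)
  F_boundary : ∀ t ∈ Ioo 0 T, ∀ i j : Fin d, NeumannZero Ω (fun y => S.F t y i j)
  lapF_boundary : ∀ t ∈ Ioo 0 T, ∀ i j : Fin d, NeumannZero Ω (lap fun y => S.F t y i j)

/-! ### Energy and dissipation -/

/-- The total energy
`E(t) = ∫_Ω ρ |u|² + λ |∇φ|² + 2 λ γ f(φ) + ν(φ) tr(F Fᵀ - I) dx`. -/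
def totalEnergy {d : ℕ} (P : Params) (Ω : Set (Space d)) (S : Fields d) (t : ℝ) : ℝ :=
  ∫ x in Ω, (P.ρ * ‖S.u t x‖ ^ 2 + P.lam * ‖gradient (S.φ t) x‖ ^ 2
    + 2 * P.lam * P.γ * P.f (S.φ t x) + P.ν (S.φ t x) * (strain (S.F t x)).trace)

/-- The dissipation
`D(t) = ∫_Ω (η(φ) |∇u|² + τ |∇μ|²) + k ∫_Ω ν(φ)² ∑ᵢⱼ |∇Fⁱʲ|² + ∫_Ω (η(φ)/κ(φ)) (1 - φ) |u|²`. -/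
def dissipation {d : ℕ} (P : Params) (Ω : Set (Space d)) (S : Fields d) (t : ℝ) : ℝ :=
  (∫ x in Ω, (P.η (S.φ t x) * (∑ i, ∑ j, jac (S.u t) x i j ^ 2)
      + P.τ * ‖gradient (chemPot P S t) x‖ ^ 2))
  + P.k * (∫ x in Ω, P.ν (S.φ t x) ^ 2 * ∑ i, ∑ j, ‖gradient (fun y => S.F t y i j) x‖ ^ 2)
  + ∫ x in Ω, P.η (S.φ t x) / P.κ (S.φ t x) * (1 - S.φ t x) * ‖S.u t x‖ ^ 2

end Thrombus

end

namespace Thrombus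

variable {d : ℕ}

/-! Testing the momentum equation with `u`, the deformation equation with `ν(φ) F` and the phase
equation with `μ` gives a pointwise identity: half the time derivative of the energy density equals
the divergence of `energyFlux` minus the dissipation density (`half_deriv_energyDensity`). All other
terms cancel for four reasons. Up to a gradient, the capillary force is `Δφ ∇φ`
(`sum_mul_mdiv_gradient_tensor`), which pairs with `-λ Δφ` in `μ`. Since `∇u` is traceless, the work
of the elastic stress balances the stretching term `∇u F` (`sum_mul_mul_eq_sum_mul_strain`). The
identity `div(ν² F ∇F) = ν² |∇F|² + ν F (ν ΔF + 2 ∇ν·∇F)`, entry by entry, shows that the diffusion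
operator for `F` is the one that dissipates the `ν`-weighted elastic energy. Finally,
differentiating `f(φ)` and `ν(φ)` along the flow produces the two remaining terms of `μ`.

On the boundary every term of the flux carries a factor `u` or a gradient with zero normal
derivative, so the flux is tangential and its divergence integrates to zero
(`integral_vdiv_eq_zero`). For tangential fields this needs no surface measure. With a local
defining function `r`, the function `dr(V)` is Lipschitz and vanishes on the boundary, hence is
`O(|r|)` (`IsLocalDefiningFunction.exists_tangential_bound`). Cutting off at depth `1/n` then costs
a term of size `n |r|`, bounded on a layer that shrinks to nothing.

Differentiation under the integral gives the energy law. The sign of the dissipation and continuity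
of the energy up to times `0` and `T` give monotonicity. -/

theorem contDiffAt_pd {n m : WithTop ℕ∞} {g : Space d → ℝ} {x : Space d} (j : Fin d)
    (hg : ContDiffAt ℝ n g x) (hmn : m + 1 ≤ n) : ContDiffAt ℝ m (pd j g) x :=
  (hg.fderiv_right hmn).clm_apply contDiffAt_const

/-- Integration by parts against the constant `1`: only the products involved have to be integrable,
so compact support of `g` suffices. -/
theorem integral_pd_eq_zero {g : Space d → ℝ} (j : Fin d) (hg : ContDiff ℝ 1 g)
    (hc : HasCompactSupport g) : ∫ x, pd j g x = 0 := by
  have hcont : Continuous (pd j g) :=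
    (hg.continuous_fderiv one_ne_zero).clm_apply continuous_const
  have hsupp : HasCompactSupport (pd j g) :=
    (hc.fderiv ℝ).comp_left (g := fun L : Space d →L[ℝ] ℝ => L (EuclideanSpace.single j 1)) rfl
  have h := integral_mul_fderiv_eq_neg_fderiv_mul_of_integrable (μ := (volume : Measure (Space d)))
    (f := fun _ => (1 : ℝ)) (g := g) (v := EuclideanSpace.single j 1) (by simp)
    (by simpa using! hcont.integrable_of_hasCompactSupport hsupp)
    (by simpa using hg.continuous.integrable_of_hasCompactSupport hc)
    (fun x _ => differentiableAt_const _) (fun x _ => hg.differentiable one_ne_zero x)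
  simpa using! h

/-! ### Geometry of the domain near a boundary point -/

/-- Lets a single `r` express the normal condition at all boundary points near `x`. -/
theorem IsLocalDefiningFunction.eventually {Ω : Set (Space d)} {x : Space d} {r : Space d → ℝ}
    (h : IsLocalDefiningFunction Ω x r) : ∀ᶠ y in 𝓝 x, IsLocalDefiningFunction Ω y r := by
  have h1 : ∀ᶠ y in 𝓝 x, ContDiffAt ℝ 2 r y := h.contDiffAt.eventually (by simp)
  have hc : ContinuousAt (gradient r) x :=
    (InnerProductSpace.toDual ℝ (Space d)).symm.continuous.continuousAt.comp
      (h.contDiffAt.fderiv_right (m := 1) (by norm_num)).continuousAt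
  filter_upwards [h1, hc.eventually_ne h.gradient_ne_zero, eventually_eventually_nhds.2 h.mem_iff]
    with y a b c using ⟨a, b, c⟩

theorem IsLocalDefiningFunction.eq_zero {Ω : Set (Space d)} {x : Space d} {r : Space d → ℝ}
    (h : IsLocalDefiningFunction Ω x r) (hΩ : IsOpen Ω) (hx : x ∈ frontier Ω) : r x = 0 := by
  have hxn : x ∉ Ω := by
    rw [hΩ.frontier_eq] at hx
    exact hx.2
  have hge : 0 ≤ r x := not_lt.1 fun hlt => hxn (h.mem_iff.self_of_nhds.2 hlt)
  refine le_antisymm ?_ hge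
  have hfr : ∃ᶠ y in 𝓝 x, y ∈ Ω := mem_closure_iff_frequently.1 (frontier_subset_closure hx)
  have hfr' : ∃ᶠ y in 𝓝 x, r y ≤ 0 :=
    (hfr.and_eventually h.mem_iff).mono fun y hy => (hy.2.1 hy.1).le
  exact le_of_tendsto_of_frequently h.contDiffAt.continuousAt hfr'

/-- The function `y ↦ dr_y(V y)` is C¹, hence locally Lipschitz, and vanishes on the boundary. It is
therefore controlled by the distance to the boundary, and that distance is at most `2|r y| /
‖∇r(x)‖`: a step of this length along `∇r(x)` leaves `Ω`. -/
theorem IsLocalDefiningFunction.exists_tangential_bound {Ω : Set (Space d)} {x : Space d}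
    {r : Space d → ℝ} {V : Space d → Space d} (h : IsLocalDefiningFunction Ω x r)
    (hΩ : IsOpen Ω) (hx : x ∈ frontier Ω) (hV : ContDiffAt ℝ 1 V x)
    (hVt : ∀ᶠ y in 𝓝 x, y ∈ frontier Ω → fderiv ℝ r y (V y) = 0) :
    ∃ C : ℝ, ∀ᶠ y in 𝓝 x, y ∈ Ω → |fderiv ℝ r y (V y)| ≤ C * |r y| := by
  set g : Space d → ℝ := fun y => fderiv ℝ r y (V y) with hg
  have hgd : ContDiffAt ℝ 1 g x :=
    (h.contDiffAt.fderiv_right (m := 1) (by norm_num)).clm_apply hV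
  obtain ⟨K, s, hs, hK⟩ := hgd.exists_lipschitzOnWith
  set e := gradient r x with he
  have hepos : 0 < ‖e‖ := norm_pos_iff.2 h.gradient_ne_zero
  have hstrict : HasStrictFDerivAt r (fderiv ℝ r x) x :=
    h.contDiffAt.hasStrictFDerivAt (by simp)
  -- Linearization error at most `‖e‖/2` per unit length, so that a step along `e` keeps at least
  -- half of its first-order gain.
  have hlo := hstrict.isLittleO.def (half_pos hepos)
  rw [nhds_prod_eq] at hlo
  obtain ⟨t, ht, hlo⟩ := mem_prod_self_iff.1 hlo
  obtain ⟨δ, hδ, hball⟩ : ∃ δ > 0, Metric.ball x δ ⊆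
      (s ∩ t) ∩ {y | (y ∈ Ω ↔ r y < 0) ∧ (y ∈ frontier Ω → g y = 0)} :=
    Metric.mem_nhds_iff.1 (inter_mem (inter_mem hs ht) (h.mem_iff.and hVt))
  have hr0 : r x = 0 := h.eq_zero hΩ hx
  refine ⟨2 * K / ‖e‖, ?_⟩
  have hrt : Tendsto (fun y => 2 * |r y| / ‖e‖) (𝓝 x) (𝓝 0) := by
    have : ContinuousAt (fun y => 2 * |r y| / ‖e‖) x := by
      have := h.contDiffAt.continuousAt
      fun_prop (disch := exact hepos.ne')
    simpa [ContinuousAt, hr0] using this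
  filter_upwards [Metric.ball_mem_nhds x (half_pos hδ), hrt.eventually_lt_const (half_pos hδ)]
    with y hy hry hyΩ
  have hin : ∀ v : Space d, ‖v‖ ≤ 2 * |r y| / ‖e‖ → y + v ∈ Metric.ball x δ := by
    intro v hv
    rw [Metric.mem_ball, dist_eq_norm] at hy ⊢
    calc ‖y + v - x‖ = ‖(y - x) + v‖ := by congr 1; abel
      _ ≤ ‖y - x‖ + ‖v‖ := norm_add_le _ _
      _ < δ := by linarith
  -- The linear part of `r` grows by `c ‖e‖² = 2|r y|` along `c • e`, and the error is at most `|r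
  -- y|`; hence `r ≥ 0` at the endpoint.
  set c : ℝ := 2 * |r y| / ‖e‖ ^ 2 with hc
  have hc0 : 0 ≤ c := by positivity
  have hce : ‖c • e‖ = 2 * |r y| / ‖e‖ := by
    rw [norm_smul, Real.norm_of_nonneg hc0, hc]
    field_simp
  have hz : y + c • e ∉ Ω := by
    have hzb := hin (c • e) hce.le
    have hyb : y ∈ Metric.ball x δ := by simpa using hin 0 (by simp; positivity)
    rw [(hball hzb).2.1]
    have hneg := (hball hyb).2.1.1 hyΩ
    have h1 := hlo (mk_mem_prod (hball hzb).1.2 (hball hyb).1.2)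
    have h2 : fderiv ℝ r x (c • e) = 2 * |r y| := by
      rw [map_smul, ← inner_gradient_left, ← he, real_inner_self_eq_norm_sq, hc, smul_eq_mul]
      field_simp
    simp only [mem_ofPred_eq, add_sub_cancel_left, h2, hce, Real.norm_eq_abs] at h1
    have h3 : ‖e‖ / 2 * (2 * |r y| / ‖e‖) = |r y| := by field_simp
    rw [h3] at h1
    have h4 := (abs_le.1 h1).1
    have h5 := abs_of_neg hneg
    linarith
  have hpre : IsPreconnected (segment ℝ y (y + c • e)) :=
    (convex_segment _ _).isPreconnected
  -- A connected set that meets `Ω` and its complement meets the frontier.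
  obtain ⟨w, hw, hwf⟩ : (segment ℝ y (y + c • e) ∩ frontier Ω).Nonempty := by
    by_contra hemp
    have := hpre.subset_of_closure_inter_subset hΩ ⟨y, left_mem_segment _ _ _, hyΩ⟩ (by
      rintro a ⟨ha, has⟩
      by_contra hna
      exact hemp ⟨a, has, by rw [hΩ.frontier_eq]; exact ⟨ha, hna⟩⟩)
    exact hz (this (right_mem_segment _ _ _))
  rw [segment_eq_image'] at hw
  obtain ⟨θ, ⟨hθ0, hθ1⟩, rfl⟩ := hw
  have hv : ‖θ • (y + c • e - y)‖ ≤ 2 * |r y| / ‖e‖ := by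
    rw [add_sub_cancel_left, norm_smul, hce, Real.norm_of_nonneg hθ0]
    exact mul_le_of_le_one_left (by positivity) hθ1
  have hwb := hin _ hv
  have hyb : y ∈ Metric.ball x δ := by simpa using hin 0 (by simp; positivity)
  have hL := hK.dist_le_mul y (hball hyb).1.1 _ (hball hwb).1.1
  have hw0 : g (y + θ • (y + c • e - y)) = 0 := (hball hwb).2.2 hwf
  rw [Real.dist_eq, hw0, sub_zero, dist_eq_norm, sub_add_cancel_left, norm_neg] at hL
  calc |g y| ≤ K * (2 * |r y| / ‖e‖) := hL.trans (by gcongr)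
    _ = 2 * K / ‖e‖ * |r y| := by ring

/-! ### Calculus of partial derivatives and the divergence -/

theorem sum_smul_single (v : Space d) : ∑ j, v j • EuclideanSpace.single j (1 : ℝ) = v := by
  simpa using (EuclideanSpace.basisFun (Fin d) ℝ).sum_repr v

theorem adv_eq_fderiv (v : Space d) (g : Space d → ℝ) (x : Space d) :
    adv v g x = fderiv ℝ g x v := by
  conv_rhs => rw [← sum_smul_single v]
  simp [adv, pd, map_sum]

theorem differentiableAt_apply {V : Space d → Space d} {x : Space d}
    (hV : DifferentiableAt ℝ V x) (j : Fin d) : DifferentiableAt ℝ (fun y => V y j) x :=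
  differentiableAt_euclidean.1 hV j

theorem pd_mul {f g : Space d → ℝ} {x : Space d} (j : Fin d) (hf : DifferentiableAt ℝ f x)
    (hg : DifferentiableAt ℝ g x) :
    pd j (fun y => f y * g y) x = f x * pd j g x + g x * pd j f x := by
  simp [pd, fderiv_fun_mul hf hg]

theorem pd_add {f g : Space d → ℝ} {x : Space d} (j : Fin d) (hf : DifferentiableAt ℝ f x)
    (hg : DifferentiableAt ℝ g x) :
    pd j (fun y => f y + g y) x = pd j f x + pd j g x := by
  simp [pd, fderiv_fun_add hf hg]

theorem pd_sum {ι : Type*} {s : Finset ι} {f : ι → Space d → ℝ} {x : Space d} (j : Fin d)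
    (hf : ∀ i ∈ s, DifferentiableAt ℝ (f i) x) :
    pd j (fun y => ∑ i ∈ s, f i y) x = ∑ i ∈ s, pd j (f i) x := by
  simp [pd, fderiv_fun_sum hf]

theorem vdiv_smul {g : Space d → ℝ} {V : Space d → Space d} {x : Space d}
    (hg : DifferentiableAt ℝ g x) (hV : DifferentiableAt ℝ V x) :
    vdiv (fun y => g y • V y) x = g x * vdiv V x + fderiv ℝ g x (V x) := by
  rw [← adv_eq_fderiv]
  simp only [vdiv, adv, PiLp.smul_apply, smul_eq_mul, Finset.mul_sum, ← Finset.sum_add_distrib]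
  exact Finset.sum_congr rfl fun j _ => pd_mul j hg (differentiableAt_apply hV j)

theorem vdiv_congr {V W : Space d → Space d} {x : Space d} (h : V =ᶠ[𝓝 x] W) :
    vdiv V x = vdiv W x := by
  refine Finset.sum_congr rfl fun j _ => ?_
  have : (fun y => V y j) =ᶠ[𝓝 x] fun y => W y j := h.mono fun y hy => by simp only [hy]
  simp only [pd, this.fderiv_eq]

theorem vdiv_zero (x : Space d) : vdiv (fun _ => (0 : Space d)) x = 0 := by
  simp [vdiv, pd]

theorem contDiffAt_apply {n : WithTop ℕ∞} {V : Space d → Space d} {x : Space d}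
    (hV : ContDiffAt ℝ n V x) (j : Fin d) : ContDiffAt ℝ n (fun y => V y j) x :=
  contDiffAt_euclidean.1 hV j

theorem continuousAt_vdiv {V : Space d → Space d} {x : Space d} (hV : ContDiffAt ℝ 1 V x) :
    ContinuousAt (vdiv V) x :=
  tendsto_finsetSum _ fun j _ =>
    (contDiffAt_pd j (contDiffAt_apply hV j) (m := 0) (by norm_num)).continuousAt

theorem integral_vdiv_eq_zero_of_contDiff {V : Space d → Space d} (hV : ContDiff ℝ 1 V)
    (hc : HasCompactSupport V) : ∫ x, vdiv V x = 0 := by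
  have hVj : ∀ j, ContDiff ℝ 1 fun y => V y j := contDiff_euclidean.1 hV
  have hcj : ∀ j, HasCompactSupport fun y => V y j := fun j =>
    hc.comp_left (g := fun v : Space d => v j) rfl
  simp only [vdiv]
  rw [integral_finsetSum]
  · exact Finset.sum_eq_zero fun j _ => integral_pd_eq_zero j (hVj j) (hcj j)
  · intro j _
    refine Continuous.integrable_of_hasCompactSupport
      (((hVj j).continuous_fderiv one_ne_zero).clm_apply continuous_const) ?_
    exact ((hcj j).fderiv ℝ).comp_left
      (g := fun L : Space d →L[ℝ] ℝ => L (EuclideanSpace.single j 1)) rfl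

/-! ### The divergence theorem for tangential fields -/

theorem exists_bound_deriv_smoothTransition :
    ∃ M : ℝ, 0 ≤ M ∧ ∀ s : ℝ, |deriv Real.smoothTransition s| ≤ M ∧
      (1 < s → deriv Real.smoothTransition s = 0) := by
  have hc : Continuous (deriv Real.smoothTransition) :=
    (Real.smoothTransition.contDiff (n := 1)).continuous_deriv le_rfl
  have h1 : ∀ s : ℝ, 1 < s → deriv Real.smoothTransition s = 0 := fun s hs => by
    have : Real.smoothTransition =ᶠ[𝓝 s] fun _ => 1 :=
      (lt_mem_nhds hs).mono fun y hy => Real.smoothTransition.one_of_one_le hy.le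
    rw [this.deriv_eq, deriv_const]
  have h0 : ∀ s : ℝ, s < 0 → deriv Real.smoothTransition s = 0 := fun s hs => by
    have : Real.smoothTransition =ᶠ[𝓝 s] fun _ => 0 :=
      (gt_mem_nhds hs).mono fun y hy => Real.smoothTransition.zero_of_nonpos hy.le
    rw [this.deriv_eq, deriv_const]
  obtain ⟨M, hM⟩ := (isCompact_Icc (a := (0 : ℝ)) (b := 1)).exists_bound_of_continuousOn
    hc.continuousOn
  have hM0 : 0 ≤ M := (norm_nonneg _).trans (hM 0 (by simp))
  refine ⟨M, hM0, fun s => ⟨?_, h1 s⟩⟩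
  by_cases hs : s ∈ Icc (0 : ℝ) 1
  · exact hM s hs
  · rw [mem_Icc, not_and_or, not_le, not_le] at hs
    rcases hs with hs | hs
    · simpa [h0 s hs] using hM0
    · simpa [h1 s hs] using hM0

/-- The cutoff `χ n` is `0` where `n r ≥ -1` and `1` where `n r ≤ -2`. Thus `χ n • W`, extended by
zero, is C¹ with compact support and its divergence has integral zero. The tangential bound
dominates the cutoff error, and dominated convergence removes the cutoff. -/
theorem integral_vdiv_eq_zero_of_local {Ω U : Set (Space d)} (hΩ : IsOpen Ω)
    (hb : Bornology.IsBounded Ω) {r : Space d → ℝ} {W : Space d → Space d}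
    (hW : ∀ x ∈ closure Ω, ContDiffAt ℝ 1 W x) (hWU : tsupport W ⊆ U)
    (hr : ∀ x ∈ U, ContDiffAt ℝ 1 r x) (hneg : ∀ x ∈ U, x ∈ Ω → r x < 0)
    (hzero : ∀ x ∈ U, x ∈ frontier Ω → r x = 0) {C : ℝ}
    (hC : ∀ x ∈ U, x ∈ Ω → |fderiv ℝ r x (W x)| ≤ C * |r x|) :
    ∫ x in Ω, vdiv W x = 0 := by
  have hK : IsCompact (closure Ω) := hb.isCompact_closure
  have hΩK : Ω ⊆ closure Ω := subset_closure
  let χ : ℕ → Space d → ℝ := fun n y => Real.smoothTransition (-(n * r y) - 1)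
  let G : ℕ → Space d → Space d := fun n => Ω.indicator fun y => χ n y • W y
  have hGin : ∀ n, ∀ y ∈ Ω, G n =ᶠ[𝓝 y] fun z => χ n z • W z := fun n y hy => by
    filter_upwards [hΩ.mem_nhds hy] with z hz using indicator_of_mem hz _
  have hWz : ∀ y, y ∉ U → W =ᶠ[𝓝 y] fun _ => 0 := fun y hy =>
    notMem_tsupport_iff_eventuallyEq.1 fun h => hy (hWU h)
  -- Off `U` the field `W` vanishes; at a frontier point of `U` the argument of the transition is
  -- `-1`, so the cutoff is zero nearby; off the closure the indicator is zero.
  have hGz : ∀ n y, y ∉ U ∨ y ∉ Ω → G n =ᶠ[𝓝 y] fun _ => 0 := by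
    intro n y hy
    by_cases hyU : y ∈ U
    · have hyΩ : y ∉ Ω := hy.resolve_left (not_not.2 hyU)
      by_cases hyc : y ∈ closure Ω
      · have hr0 : r y = 0 := hzero y hyU (by rw [hΩ.frontier_eq]; exact ⟨hyc, hyΩ⟩)
        have hcont : ContinuousAt (fun z => -(n * r z) - 1) y := by
          have := (hr y hyU).continuousAt
          fun_prop
        have hlt : ∀ᶠ z in 𝓝 y, -(n * r z) - 1 < 0 :=
          hcont.eventually_lt_const (by simp [hr0])
        filter_upwards [hlt] with z hz
        simp [G, χ, Real.smoothTransition.zero_of_nonpos hz.le]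
      · filter_upwards [isClosed_closure.isOpen_compl.mem_nhds hyc] with z hz
        exact indicator_of_notMem (fun h => hz (hΩK h)) _
    · filter_upwards [hWz y hyU] with z hz
      simp [G, hz]
  have hχ : ∀ n, ∀ y ∈ U, ContDiffAt ℝ 1 (χ n) y := fun n y hy =>
    (Real.smoothTransition.contDiff (n := 1)).contDiffAt.comp y
      (((contDiffAt_const.mul (hr y hy)).neg).sub contDiffAt_const)
  have hG : ∀ n, ContDiff ℝ 1 (G n) := by
    intro n
    rw [contDiff_iff_contDiffAt]
    intro y
    by_cases h : y ∉ U ∨ y ∉ Ω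
    · exact contDiffAt_const.congr_of_eventuallyEq (hGz n y h)
    · push Not at h
      exact ((hχ n y h.1).smul (hW y (hΩK h.2))).congr_of_eventuallyEq (hGin n y h.2)
  have hGc : ∀ n, HasCompactSupport (G n) := fun n =>
    HasCompactSupport.intro hK fun y hy => indicator_of_notMem (fun h => hy (hΩK h)) _
  have hGi : ∀ n, ∫ x in Ω, vdiv (G n) x = 0 := by
    intro n
    rw [setIntegral_eq_integral_of_forall_compl_eq_zero,
      integral_vdiv_eq_zero_of_contDiff (hG n) (hGc n)]
    intro y hy
    rw [vdiv_congr (hGz n y (Or.inr hy)), vdiv_zero]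
  obtain ⟨M₀, hM₀⟩ := hK.exists_bound_of_continuousOn (f := vdiv W)
    fun y hy => (continuousAt_vdiv (hW y hy)).continuousWithinAt
  obtain ⟨M, hM, hMd⟩ := exists_bound_deriv_smoothTransition
  -- `M₀` bounds `χ div W` and `M * (|C| * 2)` bounds `∇χ · W`. The `2` is the largest value of `n
  -- |r|` at which the derivative of the transition need not vanish.
  have hbound : ∀ n, ∀ y ∈ Ω, ‖vdiv (G n) y‖ ≤ M₀ + M * (|C| * 2) := by
    intro n y hy
    have hM₀y := hM₀ y (hΩK hy)
    by_cases hyU : y ∈ U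
    · have hrd := (hr y hyU).differentiableAt one_ne_zero
      have hfd : fderiv ℝ (χ n) y
          = deriv Real.smoothTransition (-(n * r y) - 1) • (-((n : ℝ) • fderiv ℝ r y)) := by
        have h1 : HasFDerivAt (fun z => -(n * r z) - 1) (-((n : ℝ) • fderiv ℝ r y)) y :=
          ((hrd.hasFDerivAt.const_mul (n : ℝ)).neg).sub_const 1
        have h2 : HasDerivAt Real.smoothTransition _ (-(n * r y) - 1) :=
          ((Real.smoothTransition.contDiff (n := 1)).differentiable one_ne_zero _).hasDerivAt
        exact (h2.comp_hasFDerivAt y h1).fderiv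
      rw [vdiv_congr (hGin n y hy), vdiv_smul ((hχ n y hyU).differentiableAt one_ne_zero)
        ((hW y (hΩK hy)).differentiableAt one_ne_zero), hfd]
      refine (norm_add_le _ _).trans (add_le_add ?_ ?_)
      · rw [norm_mul, Real.norm_of_nonneg (Real.smoothTransition.nonneg _)]
        exact (mul_le_of_le_one_left (norm_nonneg _) (Real.smoothTransition.le_one _)).trans hM₀y
      · simp only [smul_apply, neg_apply, smul_eq_mul, norm_mul, norm_neg, Real.norm_eq_abs, Nat.abs_cast]
        by_cases hs : 1 < -(n * r y) - 1
        · rw [(hMd _).2 hs]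
          simp; positivity
        · have habs : |r y| = - r y := abs_of_neg (hneg y hyU hy)
          have hn : (n : ℝ) * |r y| ≤ 2 := by rw [habs]; linarith
          refine mul_le_mul (hMd _).1 ?_ (by positivity) hM
          calc (n : ℝ) * |fderiv ℝ r y (W y)| ≤ n * (|C| * |r y|) := by
                gcongr
                exact (hC y hyU hy).trans (by gcongr; exact le_abs_self C)
            _ = |C| * (n * |r y|) := by ring
            _ ≤ |C| * 2 := by gcongr
    · rw [vdiv_congr (hGz n y (Or.inl hyU)), vdiv_zero, norm_zero]
      have := (norm_nonneg _).trans hM₀y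
      positivity
  have hlim : ∀ y ∈ Ω, Tendsto (fun n => vdiv (G n) y) atTop (𝓝 (vdiv W y)) := by
    intro y hy
    by_cases hyU : y ∈ U
    · refine tendsto_const_nhds.congr' ?_
      have hry := hneg y hyU hy
      -- For `n > 2/|r y|` the cutoff is identically `1` near `y`.
      obtain ⟨N, hN⟩ := exists_nat_gt (2 / -r y)
      filter_upwards [eventually_ge_atTop N] with n hn
      refine vdiv_congr ?_
      have hlt : (1 : ℝ) < -(n * r y) - 1 := by
        have h1 : (2 : ℝ) / -r y < n := hN.trans_le (by exact_mod_cast hn)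
        rw [div_lt_iff₀ (by linarith)] at h1
        linarith
      have hcont : ContinuousAt (fun z => -(n * r z) - 1) y := by
        have := (hr y hyU).continuousAt
        fun_prop
      filter_upwards [hGin n y hy, hcont.eventually_const_lt hlt] with z hz hz1
      rw [hz]
      simp [χ, Real.smoothTransition.one_of_one_le hz1.le]
    · have h1 : vdiv W y = 0 := by rw [vdiv_congr (hWz y hyU), vdiv_zero]
      have h2 : ∀ n, vdiv (G n) y = 0 := fun n => by
        rw [vdiv_congr (hGz n y (Or.inl hyU)), vdiv_zero]
      simp [h1, h2]
  have hfin : volume Ω ≠ ⊤ := hb.measure_lt_top.ne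
  have hdct := tendsto_integral_of_dominated_convergence (μ := volume.restrict Ω)
    (F := fun n y => vdiv (G n) y) (f := vdiv W) (fun _ => M₀ + M * (|C| * 2))
    (fun n => (continuous_iff_continuousAt.2 fun y =>
      continuousAt_vdiv (hG n).contDiffAt).aestronglyMeasurable)
    (integrableOn_const hfin)
    (fun n => (ae_restrict_iff' hΩ.measurableSet).2 (ae_of_all _ (hbound n)))
    ((ae_restrict_iff' hΩ.measurableSet).2 (ae_of_all _ hlim))
  simp only [hGi] at hdct
  exact tendsto_nhds_unique hdct tendsto_const_nhds

theorem vdiv_sum {ι : Type*} {s : Finset ι} {V : ι → Space d → Space d} {x : Space d}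
    (hV : ∀ i ∈ s, DifferentiableAt ℝ (V i) x) :
    vdiv (fun y => ∑ i ∈ s, V i y) x = ∑ i ∈ s, vdiv (V i) x := by
  simp only [vdiv, WithLp.ofLp_sum, Finset.sum_apply]
  rw [Finset.sum_comm]
  exact Finset.sum_congr rfl fun j _ => pd_sum j fun i hi => differentiableAt_apply (hV i hi) j

/-- Gives interior and boundary points the same local data, so that one partition of unity treats
both. At an interior point the constant `r = -1` with `C = 0` will do. -/
theorem exists_local_defining {Ω : Set (Space d)} (hΩ : IsOpen Ω) (hbd : HasC2Boundary Ω)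
    {V : Space d → Space d} (hV : ∀ x ∈ closure Ω, ContDiffAt ℝ 1 V x)
    (hn : ∀ x ∈ frontier Ω, ∀ n, IsOutwardUnitNormal Ω x n → inner ℝ n (V x) = 0)
    {x : Space d} (hx : x ∈ closure Ω) :
    ∃ (U : Set (Space d)) (r : Space d → ℝ) (C : ℝ), IsOpen U ∧ x ∈ U ∧
      ∀ y ∈ U, ContDiffAt ℝ 1 r y ∧ (y ∈ Ω → r y < 0) ∧ (y ∈ frontier Ω → r y = 0) ∧
        (y ∈ Ω → |fderiv ℝ r y (V y)| ≤ C * |r y|) := by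
  by_cases hxΩ : x ∈ Ω
  · refine ⟨Ω, fun _ => -1, 0, hΩ, hxΩ, fun y hy => ⟨contDiffAt_const, by simp, fun h => ?_,
      by simp⟩⟩
    rw [hΩ.frontier_eq] at h
    exact absurd hy h.2
  · have hxf : x ∈ frontier Ω := by rw [hΩ.frontier_eq]; exact ⟨hx, hxΩ⟩
    obtain ⟨r, hr⟩ := hbd x hxf
    have hev := hr.eventually
    have hVt : ∀ᶠ y in 𝓝 x, y ∈ frontier Ω → fderiv ℝ r y (V y) = 0 := by
      filter_upwards [hev] with y hy hyf
      -- The normal is a positive multiple of `∇r`, so `n · V = 0` amounts to `dr(V) = 0`.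
      have := hn y hyf _ ⟨r, hy, rfl⟩
      rw [inner_smul_left, inner_gradient_left] at this
      simpa [hy.gradient_ne_zero] using this
    obtain ⟨C, hC⟩ := hr.exists_tangential_bound hΩ hxf (hV x hx) hVt
    obtain ⟨U, hUs, hUo, hxU⟩ := mem_nhds_iff.1 (hev.and hC)
    refine ⟨U, r, C, hUo, hxU, fun y hy => ?_⟩
    obtain ⟨h1, h2⟩ := hUs hy
    exact ⟨h1.contDiffAt.of_le (by norm_num), fun h => h1.mem_iff.self_of_nhds.1 h,
      fun h => h1.eq_zero hΩ h, h2⟩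

/-- The divergence theorem for a vector field that is tangent to the boundary. -/
theorem integral_vdiv_eq_zero {Ω : Set (Space d)} (hΩ : IsOpen Ω)
    (hb : Bornology.IsBounded Ω) (hbd : HasC2Boundary Ω)
    {V : Space d → Space d} (hV : ∀ x ∈ closure Ω, ContDiffAt ℝ 1 V x)
    (hn : ∀ x ∈ frontier Ω, ∀ n, IsOutwardUnitNormal Ω x n → inner ℝ n (V x) = 0) :
    ∫ x in Ω, vdiv V x = 0 := by
  have hK : IsCompact (closure Ω) := hb.isCompact_closure
  have hloc := fun x : closure Ω => exists_local_defining hΩ hbd hV hn x.2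
  choose U r C hUo hxU hU using hloc
  obtain ⟨f, hf⟩ := SmoothPartitionOfUnity.exists_isSubordinate (modelWithCornersSelf ℝ (Space d))
    isClosed_closure U hUo (fun x hx => mem_iUnion_of_mem (⟨x, hx⟩ : closure Ω) (hxU ⟨x, hx⟩))
  have hfd : ∀ i, ContDiff ℝ 1 (f i) := fun i =>
    (f i).contMDiff.contDiff.of_le (by exact_mod_cast le_top)
  have hfin : {i | (Function.support (f i) ∩ closure Ω).Nonempty}.Finite :=
    f.locallyFinite.finite_nonempty_inter_compact hK
  set s := hfin.toFinset with hs
  have hsum : ∀ y ∈ closure Ω, ∑ i ∈ s, f i y = 1 := by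
    intro y hy
    rw [← f.sum_eq_one hy, finsum_eq_sum_of_support_subset]
    intro i hi
    simp only [hs, Finite.coe_toFinset]
    exact ⟨y, hi, hy⟩
  have hW : ∀ i, ∀ x ∈ closure Ω, ContDiffAt ℝ 1 (fun y => f i y • V y) x := fun i x hx =>
    (hfd i).contDiffAt.smul (hV x hx)
  have hdiv : ∀ x ∈ Ω, vdiv V x = ∑ i ∈ s, vdiv (fun y => f i y • V y) x := by
    intro x hx
    rw [← vdiv_sum fun i _ => (hW i x (subset_closure hx)).differentiableAt one_ne_zero]
    refine vdiv_congr ?_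
    filter_upwards [hΩ.mem_nhds hx] with y hy
    rw [← Finset.sum_smul, hsum y (subset_closure hy), one_smul]
  rw [setIntegral_congr_fun hΩ.measurableSet hdiv, integral_finsetSum]
  · refine Finset.sum_eq_zero fun i _ => ?_
    refine integral_vdiv_eq_zero_of_local hΩ hb (r := r i) (C := C i) (hW i)
      ((closure_mono (Function.support_smul_subset_left _ _)).trans (hf i))
      (fun x hx => (hU i x hx).1) (fun x hx => (hU i x hx).2.1) (fun x hx => (hU i x hx).2.2.1)
      fun x hx hxΩ => ?_
    -- A weight in `[0,1]` preserves the tangential bound with the same constant.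
    rw [map_smul, smul_eq_mul, abs_mul, abs_of_nonneg (f.nonneg i x)]
    exact (mul_le_of_le_one_left (abs_nonneg _) (f.le_one i x)).trans ((hU i x hx).2.2.2 hxΩ)
  · intro i _
    exact (ContinuousOn.integrableOn_compact hK fun x hx =>
      (continuousAt_vdiv (hW i x hx)).continuousWithinAt).mono_set subset_closure

/-! ### Integrals over the domain as functions of time -/

/-- Differentiation under the integral sign over a bounded set, for an integrand that is
continuously differentiable up to the boundary. -/
theorem hasDerivAt_integral_of_contDiffAt {Ω : Set (Space d)} (hΩ : IsOpen Ω)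
    (hb : Bornology.IsBounded Ω) {a b t : ℝ} (ht : t ∈ Ioo a b) {e : ℝ × Space d → ℝ}
    (he : ∀ s ∈ Ioo a b, ∀ x ∈ closure Ω, ContDiffAt ℝ 1 e (s, x)) :
    HasDerivAt (fun s => ∫ x in Ω, e (s, x)) (∫ x in Ω, deriv (fun s => e (s, x)) t) t := by
  have hK : IsCompact (closure Ω) := hb.isCompact_closure
  -- A compact time interval around `t` makes the time derivative uniformly bounded, so a constant
  -- dominates.
  obtain ⟨ε, hε, hball⟩ := Metric.nhds_basis_closedBall.mem_iff.1 (isOpen_Ioo.mem_nhds ht)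
  have hcpt : IsCompact (Metric.closedBall t ε ×ˢ closure Ω) :=
    (isCompact_closedBall t ε).prod hK
  let e' : ℝ → Space d → ℝ := fun s x => fderiv ℝ e (s, x) (1, 0)
  have he'c : ∀ s ∈ Ioo a b, ∀ x ∈ closure Ω,
      ContinuousAt (fun z : ℝ × Space d => e' z.1 z.2) (s, x) := fun s hs x hx =>
    (((he s hs x hx).fderiv_right (m := 0) (by norm_num)).clm_apply contDiffAt_const).continuousAt
  have hder : ∀ s ∈ Ioo a b, ∀ x ∈ closure Ω, HasDerivAt (fun s => e (s, x)) (e' s x) s := by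
    intro s hs x hx
    have h1 : HasDerivAt (fun s : ℝ => (s, x)) (1, 0) s :=
      (hasDerivAt_id s).prodMk (hasDerivAt_const s x)
    exact (((he s hs x hx).differentiableAt one_ne_zero).hasFDerivAt).comp_hasDerivAt s h1
  obtain ⟨M, hM⟩ := hcpt.exists_bound_of_continuousOn (f := fun z : ℝ × Space d => e' z.1 z.2)
    fun z hz => (he'c z.1 (hball hz.1) z.2 hz.2).continuousWithinAt
  have hslice : ∀ s ∈ Ioo a b, IntegrableOn (fun x => e (s, x)) Ω := fun s hs =>
    (ContinuousOn.integrableOn_compact hK fun x hx =>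
      ((he s hs x hx).continuousAt.comp (by fun_prop : ContinuousAt (fun y => (s, y)) x)
        ).continuousWithinAt).mono_set subset_closure
  have hslice' : IntegrableOn (e' t) Ω :=
    (ContinuousOn.integrableOn_compact hK fun x hx =>
      ((he'c t ht x hx).comp (f := fun y => (t, y)) (by fun_prop)).continuousWithinAt).mono_set
        subset_closure
  have hmain := (hasDerivAt_integral_of_dominated_loc_of_deriv_le (μ := volume.restrict Ω)
    (F := fun s x => e (s, x)) (F' := e') (bound := fun _ => M)
    (Metric.closedBall_mem_nhds t hε)
    (mem_of_superset (isOpen_Ioo.mem_nhds ht) fun s hs => (hslice s hs).aestronglyMeasurable)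
    (hslice t ht) hslice'.aestronglyMeasurable
    ((ae_restrict_iff' hΩ.measurableSet).2 (ae_of_all _ fun x hx s hs =>
      hM (s, x) ⟨hs, subset_closure hx⟩))
    (integrableOn_const hb.measure_lt_top.ne)
    ((ae_restrict_iff' hΩ.measurableSet).2 (ae_of_all _ fun x hx s hs =>
      hder s (hball hs) x (subset_closure hx)))).2
  rw [setIntegral_congr_fun hΩ.measurableSet fun x hx => (hder t ht x (subset_closure hx)).deriv]
  exact hmain

theorem continuousOn_integral_of_bounded {Ω : Set (Space d)} (hΩ : IsOpen Ω)
    (hb : Bornology.IsBounded Ω) {a b : ℝ} {e : ℝ × Space d → ℝ}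
    (he : ContinuousOn e (Icc a b ×ˢ closure Ω)) :
    ContinuousOn (fun s => ∫ x in Ω, e (s, x)) (Icc a b) := by
  have hK : IsCompact (closure Ω) := hb.isCompact_closure
  obtain ⟨M, hM⟩ := (isCompact_Icc.prod hK).exists_bound_of_continuousOn he
  refine continuousOn_of_dominated (bound := fun _ => M) (fun s hs => ?_) (fun s hs => ?_)
    (integrableOn_const hb.measure_lt_top.ne) ?_
  · refine ((ContinuousOn.integrableOn_compact hK ?_).mono_set
      subset_closure).aestronglyMeasurable
    exact he.comp (by fun_prop) fun x hx => ⟨hs, hx⟩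
  · exact (ae_restrict_iff' hΩ.measurableSet).2 (ae_of_all _ fun x hx =>
      hM (s, x) ⟨hs, subset_closure hx⟩)
  · exact (ae_restrict_iff' hΩ.measurableSet).2 (ae_of_all _ fun x hx =>
      he.comp (by fun_prop) fun s hs => ⟨hs, subset_closure hx⟩)

/-! ### Slices and mixed derivatives of functions of time and space -/

section Joint

variable {n m : WithTop ℕ∞} {g : ℝ → Space d → ℝ} {t : ℝ} {x : Space d}

theorem contDiffAt_slice (hg : ContDiffAt ℝ n (fun z : ℝ × Space d => g z.1 z.2) (t, x)) :
    ContDiffAt ℝ n (g t) x :=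
  hg.comp (f := fun y : Space d => (t, y)) x (contDiffAt_const.prodMk contDiffAt_id)

theorem pd_slice (j : Fin d)
    (hg : DifferentiableAt ℝ (fun z : ℝ × Space d => g z.1 z.2) (t, x)) :
    pd j (g t) x = fderiv ℝ (fun z : ℝ × Space d => g z.1 z.2) (t, x)
      (0, EuclideanSpace.single j 1) := by
  have h1 : HasFDerivAt (fun y : Space d => (t, y))
      ((0 : Space d →L[ℝ] ℝ).prod (ContinuousLinearMap.id ℝ (Space d))) x :=
    (hasFDerivAt_const t x).prodMk (hasFDerivAt_id x)
  have h2 := hg.hasFDerivAt.comp x h1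
  have h3 : fderiv ℝ (g t) x = _ := h2.fderiv
  rw [pd, h3]
  simp

theorem hasDerivAt_slice
    (hg : DifferentiableAt ℝ (fun z : ℝ × Space d => g z.1 z.2) (t, x)) :
    HasDerivAt (fun s => g s x)
      (fderiv ℝ (fun z : ℝ × Space d => g z.1 z.2) (t, x) (1, 0)) t := by
  have h1 : HasDerivAt (fun s : ℝ => (s, x)) (1, 0) t :=
    (hasDerivAt_id t).prodMk (hasDerivAt_const t x)
  exact hg.hasFDerivAt.comp_hasDerivAt t h1

theorem eventually_differentiableAt {E : Type*} [NormedAddCommGroup E] [NormedSpace ℝ E]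
    {f : E → ℝ} {z : E} (hf : ContDiffAt ℝ 1 f z) : ∀ᶠ y in 𝓝 z, DifferentiableAt ℝ f y :=
  (hf.eventually (by simp)).mono fun _ hy => hy.differentiableAt one_ne_zero

theorem one_le_of_add_one_le (hmn : m + 1 ≤ n) : 1 ≤ n := le_trans (by simp) hmn

theorem contDiffAt_pd_joint (j : Fin d)
    (hg : ContDiffAt ℝ n (fun z : ℝ × Space d => g z.1 z.2) (t, x)) (hmn : m + 1 ≤ n) :
    ContDiffAt ℝ m (fun z : ℝ × Space d => pd j (g z.1) z.2) (t, x) := by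
  refine ((hg.fderiv_right hmn).clm_apply
    (contDiffAt_const (c := ((0 : ℝ), EuclideanSpace.single j (1 : ℝ))))).congr_of_eventuallyEq ?_
  filter_upwards [eventually_differentiableAt (hg.of_le (one_le_of_add_one_le hmn))] with z hz
  exact pd_slice j hz

theorem contDiffAt_deriv_joint
    (hg : ContDiffAt ℝ n (fun z : ℝ × Space d => g z.1 z.2) (t, x)) (hmn : m + 1 ≤ n) :
    ContDiffAt ℝ m (fun z : ℝ × Space d => deriv (fun s => g s z.2) z.1) (t, x) := by
  refine ((hg.fderiv_right hmn).clm_apply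
    (contDiffAt_const (c := ((1 : ℝ), (0 : Space d))))).congr_of_eventuallyEq ?_
  filter_upwards [eventually_differentiableAt (hg.of_le (one_le_of_add_one_le hmn))] with z hz
  exact (hasDerivAt_slice hz).deriv

/-- Symmetry of the second derivative of the joint function, evaluated on the directions `(1, 0)`
and `(0, eⱼ)`. -/
theorem deriv_pd_comm (j : Fin d)
    (hg : ContDiffAt ℝ 2 (fun z : ℝ × Space d => g z.1 z.2) (t, x)) :
    deriv (fun s => pd j (g s) x) t = pd j (fun y => deriv (fun s => g s y) t) x := by
  set Φ := fun z : ℝ × Space d => g z.1 z.2 with hΦ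
  have hev := eventually_differentiableAt (hg.of_le (by norm_num))
  have hd : DifferentiableAt ℝ (fderiv ℝ Φ) (t, x) :=
    (hg.fderiv_right (m := 1) (by norm_num)).differentiableAt one_ne_zero
  have hsymm : IsSymmSndFDerivAt ℝ Φ (t, x) := hg.isSymmSndFDerivAt (by simp)
  have h1 : (fun s => pd j (g s) x) =ᶠ[𝓝 t]
      fun s => fderiv ℝ Φ (s, x) (0, EuclideanSpace.single j 1) := by
    have hc : ContinuousAt (fun s : ℝ => (s, x)) t := by fun_prop
    filter_upwards [hc.eventually hev] with s hs using pd_slice j hs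
  have h2 : (fun y => deriv (fun s => g s y) t) =ᶠ[𝓝 x] fun y => fderiv ℝ Φ (t, y) (1, 0) := by
    have hc : ContinuousAt (fun y : Space d => (t, y)) x := by fun_prop
    filter_upwards [hc.eventually hev] with y hy using (hasDerivAt_slice hy).deriv
  have hd1 : DifferentiableAt ℝ
      (fun z : ℝ × Space d => fderiv ℝ Φ z (0, EuclideanSpace.single j 1)) (t, x) :=
    hd.clm_apply (differentiableAt_const _)
  have hd2 : DifferentiableAt ℝ (fun z : ℝ × Space d => fderiv ℝ Φ z (1, 0)) (t, x) :=
    hd.clm_apply (differentiableAt_const _)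
  have e1 := (hasDerivAt_slice
    (g := fun s y => fderiv ℝ Φ (s, y) (0, EuclideanSpace.single j 1)) hd1).deriv
  have e2 := pd_slice (g := fun s y => fderiv ℝ Φ (s, y) (1, 0)) j hd2
  rw [h1.deriv_eq, e1, pd, h2.fderiv_eq, ← pd, e2]
  simp only [Prod.mk.eta]
  rw [fderiv_clm_apply hd (differentiableAt_const _), fderiv_clm_apply hd (differentiableAt_const _)]
  simpa using hsymm _ _

end Joint

/-! ### Product rules and identities at a fixed time -/

section Spatial

variable {f g : Space d → ℝ} {v : Space d} {x : Space d}

theorem pd_comm (i j : Fin d) (hg : ContDiffAt ℝ 2 g x) :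
    pd i (pd j g) x = pd j (pd i g) x := by
  have hd : DifferentiableAt ℝ (fderiv ℝ g) x :=
    (hg.fderiv_right (m := 1) (by norm_num)).differentiableAt one_ne_zero
  have h : ∀ a b : Fin d, pd a (pd b g) x
      = fderiv ℝ (fderiv ℝ g) x (EuclideanSpace.single a 1) (EuclideanSpace.single b 1) := by
    intro a b
    change fderiv ℝ (fun y => fderiv ℝ g y (EuclideanSpace.single b 1)) x _ = _
    rw [fderiv_clm_apply hd (differentiableAt_const _)]
    simp
  rw [h, h]
  exact (hg.isSymmSndFDerivAt (by simp)) _ _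

theorem gradient_apply (g : Space d → ℝ) (x : Space d) (j : Fin d) : gradient g x j = pd j g x := by
  rw [pd, ← inner_gradient_left, EuclideanSpace.inner_single_right]
  simp

theorem norm_sq_gradient (g : Space d → ℝ) (x : Space d) :
    ‖gradient g x‖ ^ 2 = ∑ j, pd j g x ^ 2 := by
  simp [EuclideanSpace.real_norm_sq_eq, gradient_apply]

theorem contDiffAt_gradient {n m : WithTop ℕ∞} (hg : ContDiffAt ℝ n g x) (hmn : m + 1 ≤ n) :
    ContDiffAt ℝ m (gradient g) x :=
  (InnerProductSpace.toDual ℝ (Space d)).symm.toContinuousLinearEquiv.contDiff.contDiffAt.comp x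
    (hg.fderiv_right hmn)

theorem contDiffAt_lap {n m : WithTop ℕ∞} (hg : ContDiffAt ℝ n g x) (hmn : m + 1 + 1 ≤ n) :
    ContDiffAt ℝ m (lap g) x :=
  ContDiffAt.sum fun j _ => contDiffAt_pd j (contDiffAt_pd j hg hmn) le_rfl

theorem adv_add (hf : DifferentiableAt ℝ f x) (hg : DifferentiableAt ℝ g x) :
    adv v (fun y => f y + g y) x = adv v f x + adv v g x := by
  simp [adv_eq_fderiv, fderiv_fun_add hf hg]

theorem adv_mul (hf : DifferentiableAt ℝ f x) (hg : DifferentiableAt ℝ g x) :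
    adv v (fun y => f y * g y) x = f x * adv v g x + g x * adv v f x := by
  simp [adv_eq_fderiv, fderiv_fun_mul hf hg]

theorem adv_const_mul (c : ℝ) (hg : DifferentiableAt ℝ g x) :
    adv v (fun y => c * g y) x = c * adv v g x := by
  simp [adv_eq_fderiv, fderiv_const_mul hg]

theorem adv_sub_const (c : ℝ) : adv v (fun y => g y - c) x = adv v g x := by
  simp [adv_eq_fderiv, fderiv_sub_const]

theorem adv_sum {ι : Type*} {s : Finset ι} {f : ι → Space d → ℝ}
    (hf : ∀ i ∈ s, DifferentiableAt ℝ (f i) x) :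
    adv v (fun y => ∑ i ∈ s, f i y) x = ∑ i ∈ s, adv v (f i) x := by
  simp [adv_eq_fderiv, fderiv_fun_sum hf]

theorem adv_sq (hg : DifferentiableAt ℝ g x) :
    adv v (fun y => g y ^ 2) x = 2 * (g x * adv v g x) := by
  simp only [pow_two]
  rw [adv_mul hg hg]
  ring

theorem adv_comp {h : ℝ → ℝ} (hh : DifferentiableAt ℝ h (g x)) (hg : DifferentiableAt ℝ g x) :
    adv v (fun y => h (g y)) x = deriv h (g x) * adv v g x := by
  have := (hh.hasDerivAt.comp_hasFDerivAt x hg.hasFDerivAt).fderiv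
  rw [adv_eq_fderiv, adv_eq_fderiv]
  exact (congrArg (fun L : Space d →L[ℝ] ℝ => L v) this).trans (by simp)

theorem vdiv_add {V W : Space d → Space d} (hV : DifferentiableAt ℝ V x)
    (hW : DifferentiableAt ℝ W x) : vdiv (fun y => V y + W y) x = vdiv V x + vdiv W x := by
  simp only [vdiv, PiLp.add_apply, ← Finset.sum_add_distrib]
  exact Finset.sum_congr rfl fun j _ =>
    pd_add j (differentiableAt_apply hV j) (differentiableAt_apply hW j)

theorem vdiv_smul_gradient (hf : DifferentiableAt ℝ f x) (hg : ContDiffAt ℝ 2 g x) :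
    vdiv (fun y => f y • gradient g y) x = f x * lap g x + ∑ j, pd j f x * pd j g x := by
  rw [vdiv_smul hf ((contDiffAt_gradient hg (m := 1) (by norm_num)).differentiableAt one_ne_zero),
    ← adv_eq_fderiv]
  simp only [vdiv, adv, lap, gradient_apply, mul_comm]

theorem vdiv_vecMul {V : Space d → Space d} {M : Space d → Matrix (Fin d) (Fin d) ℝ}
    (hV : DifferentiableAt ℝ V x) (hM : ∀ i j, DifferentiableAt ℝ (fun y => M y i j) x) :
    vdiv (fun y => WithLp.toLp 2 fun j => ∑ i, V y i * M y i j) x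
      = ∑ i, V x i * mdiv M i x + ∑ i, ∑ j, jac V x i j * M x i j := by
  have hVi := fun i => differentiableAt_apply hV i
  have h1 : ∀ j, pd j (fun y => ∑ i, V y i * M y i j) x
      = ∑ i, (V x i * pd j (fun y => M y i j) x + M x i j * pd j (fun y => V y i) x) := by
    intro j
    rw [pd_sum (f := fun i y => V y i * M y i j) j fun i _ => (hVi i).mul (hM i j)]
    exact Finset.sum_congr rfl fun i _ => pd_mul j (hVi i) (hM i j)
  simp only [vdiv, h1, mdiv, jac, Matrix.of_apply, Finset.mul_sum]
  rw [Finset.sum_comm]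
  simp only [Finset.sum_add_distrib, mul_comm]

theorem mdiv_add {M N : Space d → Matrix (Fin d) (Fin d) ℝ} (i : Fin d)
    (hM : ∀ i j, DifferentiableAt ℝ (fun y => M y i j) x)
    (hN : ∀ i j, DifferentiableAt ℝ (fun y => N y i j) x) :
    mdiv (fun y => M y + N y) i x = mdiv M i x + mdiv N i x := by
  simp only [mdiv, Matrix.add_apply, ← Finset.sum_add_distrib]
  exact Finset.sum_congr rfl fun j _ => pd_add j (hM i j) (hN i j)

/-- `v · ∇·(∇g ⊗ ∇g) = Δg (v · ∇g) + ½ v · ∇|∇g|²`. -/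
theorem sum_mul_mdiv_gradient_tensor (hg : ContDiffAt ℝ 2 g x) :
    ∑ i, v i * mdiv (fun y => Matrix.of fun a b => pd a g y * pd b g y) i x
      = lap g x * adv v g x + 1 / 2 * adv v (fun y => ∑ j, pd j g y ^ 2) x := by
  have hd : ∀ j, DifferentiableAt ℝ (pd j g) x := fun j =>
    (contDiffAt_pd j hg (m := 1) (by norm_num)).differentiableAt one_ne_zero
  have h1 : ∀ i, mdiv (fun y => Matrix.of fun a b => pd a g y * pd b g y) i x
      = pd i g x * lap g x + ∑ j, pd j g x * pd i (pd j g) x := by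
    intro i
    simp only [mdiv, Matrix.of_apply, lap, Finset.mul_sum, ← Finset.sum_add_distrib]
    refine Finset.sum_congr rfl fun j _ => ?_
    rw [pd_mul j (hd i) (hd j), pd_comm i j hg]
  rw [adv_sum (f := fun j y => pd j g y ^ 2) fun j _ => (hd j).pow 2]
  simp only [fun j => adv_sq (v := v) (hd j), h1, mul_add, Finset.sum_add_distrib]
  congr 1
  · rw [adv, Finset.mul_sum]
    exact Finset.sum_congr rfl fun i _ => by ring
  · simp only [adv, Finset.mul_sum]
    rw [Finset.sum_comm]
    exact Finset.sum_congr rfl fun i _ => Finset.sum_congr rfl fun j _ => by ring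

end Spatial

/-! ### Algebra of the strain -/

theorem strain_apply (A : Matrix (Fin d) (Fin d) ℝ) (i j : Fin d) :
    strain A i j = ∑ l, A i l * A j l - (1 : Matrix (Fin d) (Fin d) ℝ) i j := by
  simp [strain, Matrix.mul_apply]

theorem trace_strain (A : Matrix (Fin d) (Fin d) ℝ) :
    (strain A).trace = (∑ i, ∑ j, A i j ^ 2) - d := by
  simp [Matrix.trace, strain_apply, Finset.sum_sub_distrib, pow_two]

/-- `A : BA = B : (AAᵀ - I)` for a traceless matrix `B`. -/
theorem sum_mul_mul_eq_sum_mul_strain (A B : Matrix (Fin d) (Fin d) ℝ) (hB : ∑ i, B i i = 0) :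
    ∑ i, ∑ j, A i j * (B * A) i j = ∑ i, ∑ j, B i j * strain A i j := by
  simp only [strain_apply, mul_sub, Finset.sum_sub_distrib, Matrix.one_apply, mul_ite, mul_one,
    mul_zero, Finset.sum_ite_eq, Finset.mem_univ, if_true, hB, sub_zero, Matrix.mul_apply,
    Finset.mul_sum]
  refine Finset.sum_congr rfl fun i _ => ?_
  rw [Finset.sum_comm]
  exact Finset.sum_congr rfl fun j _ => Finset.sum_congr rfl fun l _ => by ring

end Thrombus

noncomputable section

namespace Thrombus

variable {d : ℕ} {P : Params} {Ω : Set (Space d)} {T t : ℝ} {S : Fields d} {x : Space d}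

/-! ### Regularity of the composite quantities -/

theorem Params.contDiff_f (P : Params) {n : WithTop ℕ∞} : ContDiff ℝ n P.f := by
  unfold Params.f
  fun_prop

theorem contDiff_deriv {n m : WithTop ℕ∞} {f : ℝ → ℝ} (hf : ContDiff ℝ n f) (hmn : m + 1 ≤ n) :
    ContDiff ℝ m (deriv f) := by
  have h : deriv f = fun s => fderiv ℝ f s 1 := funext fun s => fderiv_apply_one_eq_deriv.symm
  rw [h]
  exact (hf.fderiv_right hmn).clm_apply contDiff_const

theorem contDiffAt_trace_strain {E : Type*} [NormedAddCommGroup E] [NormedSpace ℝ E]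
    {n : WithTop ℕ∞} {A : E → Matrix (Fin d) (Fin d) ℝ} {z : E}
    (hA : ∀ i j, ContDiffAt ℝ n (fun y => A y i j) z) :
    ContDiffAt ℝ n (fun y => (strain (A y)).trace) z := by
  simp only [trace_strain]
  exact (ContDiffAt.sum fun i _ => ContDiffAt.sum fun j _ => (hA i j).pow 2).sub contDiffAt_const

theorem contDiffAt_strain_apply {n : WithTop ℕ∞} {A : Space d → Matrix (Fin d) (Fin d) ℝ}
    (hA : ∀ i j, ContDiffAt ℝ n (fun y => A y i j) x) (i j : Fin d) :
    ContDiffAt ℝ n (fun y => strain (A y) i j) x := by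
  simp only [strain_apply]
  exact (ContDiffAt.sum fun l _ => (hA i l).mul (hA j l)).sub contDiffAt_const

namespace IsRegular

variable (hR : IsRegular Ω T S) (ht : t ∈ Ioo 0 T) (hx : x ∈ closure Ω)

include hR ht hx

theorem u_joint_apply (i : Fin d) :
    ContDiffAt ℝ 2 (fun z : ℝ × Space d => S.u z.1 z.2 i) (t, x) :=
  contDiffAt_euclidean.1 (hR.u_smooth t ht x hx) i

theorem u_apply (i : Fin d) : ContDiffAt ℝ 2 (fun y => S.u t y i) x :=
  contDiffAt_slice (g := fun s y => S.u s y i) (hR.u_joint_apply ht hx i)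

theorem u : ContDiffAt ℝ 2 (S.u t) x := contDiffAt_euclidean.2 (hR.u_apply ht hx)

theorem φ : ContDiffAt ℝ 4 (S.φ t) x := contDiffAt_slice (hR.φ_smooth t ht x hx)

theorem deriv_φ : ContDiffAt ℝ 3 (fun y => deriv (fun s => S.φ s y) t) x :=
  contDiffAt_slice (g := fun s y => deriv (fun s' => S.φ s' y) s)
    (contDiffAt_deriv_joint (hR.φ_smooth t ht x hx) (by norm_num))

theorem F (i j : Fin d) : ContDiffAt ℝ 3 (fun y => S.F t y i j) x :=
  contDiffAt_slice (g := fun s y => S.F s y i j) (hR.F_smooth t ht x hx i j)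

theorem ν_φ (hP : P.Admissible) : ContDiffAt ℝ 3 (fun y => P.ν (S.φ t y)) x :=
  hP.ν_contDiff.contDiffAt.comp x ((hR.φ ht hx).of_le (by norm_num))

theorem η_φ (hP : P.Admissible) : ContDiffAt ℝ 1 (fun y => P.η (S.φ t y)) x :=
  hP.η_contDiff.contDiffAt.comp x ((hR.φ ht hx).of_le (by norm_num))

theorem f_φ : ContDiffAt ℝ 4 (fun y => P.f (S.φ t y)) x :=
  P.contDiff_f.contDiffAt.comp x (hR.φ ht hx)

/-- Four derivatives of `φ` and three of `ν` make `Δφ` and `ν'(φ)` of class C², so that the flux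
term `μ ∇μ` is C¹ up to the boundary. -/
theorem chemPot (hP : P.Admissible) : ContDiffAt ℝ 2 (chemPot P S t) x := by
  have h1 : ContDiffAt ℝ 2 (lap (S.φ t)) x := contDiffAt_lap (hR.φ ht hx) (by norm_num)
  have hφ : ContDiffAt ℝ 2 (S.φ t) x := (hR.φ ht hx).of_le (by norm_num)
  have h2 : ContDiffAt ℝ 2 (fun y => deriv P.f (S.φ t y)) x :=
    (contDiff_deriv (P.contDiff_f (n := 3)) (by norm_num)).contDiffAt.comp x hφ
  have h3 : ContDiffAt ℝ 2 (fun y => deriv P.ν (S.φ t y)) x :=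
    (contDiff_deriv hP.ν_contDiff (by norm_num)).contDiffAt.comp x hφ
  have h4 : ContDiffAt ℝ 2 (fun y => (strain (S.F t y)).trace) x :=
    contDiffAt_trace_strain fun i j => (hR.F ht hx i j).of_le (by norm_num)
  exact ((contDiffAt_const.mul h1).add (contDiffAt_const.mul h2)).add
    ((h3.div_const 2).mul h4)

theorem jac (i j : Fin d) : ContDiffAt ℝ 1 (fun y => jac (S.u t) y i j) x :=
  contDiffAt_pd j (hR.u_apply ht hx i) (by norm_num)

theorem strain (i j : Fin d) : ContDiffAt ℝ 3 (fun y => strain (S.F t y) i j) x :=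
  contDiffAt_strain_apply (hR.F ht hx) i j

end IsRegular

/-! ### The energy balance in divergence form -/

/-- The integrand of the total energy. -/
def energyDensity (P : Params) (S : Fields d) (t : ℝ) (x : Space d) : ℝ :=
  P.ρ * ‖S.u t x‖ ^ 2 + P.lam * ‖gradient (S.φ t) x‖ ^ 2
    + 2 * P.lam * P.γ * P.f (S.φ t x) + P.ν (S.φ t x) * (strain (S.F t x)).trace

/-- The viscous and elastic stress `η ∇u + ν (F Fᵀ - I)`. -/
def stress (P : Params) (S : Fields d) (t : ℝ) (x : Space d) : Matrix (Fin d) (Fin d) ℝ :=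
  P.η (S.φ t x) • jac (S.u t) x + P.ν (S.φ t x) • strain (S.F t x)

/-- The energy transported by the flow: pressure plus half of the energy density. -/
def head (P : Params) (S : Fields d) (t : ℝ) (x : Space d) : ℝ :=
  P.ρ / 2 * (∑ i, S.u t x i ^ 2) + S.p t x + P.lam / 2 * (∑ j, pd j (S.φ t) x ^ 2)
    + P.lam * P.γ * P.f (S.φ t x) + 1 / 2 * (P.ν (S.φ t x) * (strain (S.F t x)).trace)

/-- The vector field whose divergence is half the time derivative of the energy density plus the
dissipation density. -/
def energyFlux (P : Params) (S : Fields d) (t : ℝ) (x : Space d) : Space d :=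
  (-1 * head P S t x) • S.u t x
    + (P.lam * deriv (fun s => S.φ s x) t) • gradient (S.φ t) x
    + (P.τ * chemPot P S t x) • gradient (chemPot P S t) x
    + (∑ a, ∑ b, (P.k * P.ν (S.φ t x) ^ 2 * S.F t x a b) • gradient (fun y => S.F t y a b) x)
    + WithLp.toLp 2 (fun j => ∑ i, S.u t x i * stress P S t x i j)

namespace IsRegular

variable (hR : IsRegular Ω T S) (hP : P.Admissible) (ht : t ∈ Ioo 0 T) (hx : x ∈ closure Ω)

include hR hP ht hx

theorem stress (i j : Fin d) : ContDiffAt ℝ 1 (fun y => stress P S t y i j) x :=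
  ((hR.η_φ ht hx hP).mul (hR.jac ht hx i j)).add
    (((hR.ν_φ ht hx hP).mul (hR.strain ht hx i j)).of_le (by norm_num))

theorem head : ContDiffAt ℝ 1 (head P S t) x := by
  have h1 : ContDiffAt ℝ 1 (fun y => ∑ i, S.u t y i ^ 2) x :=
    ContDiffAt.sum fun i _ => ((hR.u_apply ht hx i).of_le (by norm_num)).pow 2
  have h2 : ContDiffAt ℝ 1 (fun y => ∑ j, pd j (S.φ t) y ^ 2) x :=
    ContDiffAt.sum fun j _ => (contDiffAt_pd j (hR.φ ht hx) (by norm_num)).pow 2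
  have h3 : ContDiffAt ℝ 1 (fun y => P.f (S.φ t y)) x := (hR.f_φ ht hx).of_le (by norm_num)
  have h4 : ContDiffAt ℝ 1 (fun y => P.ν (S.φ t y)) x := (hR.ν_φ ht hx hP).of_le (by norm_num)
  have h5 : ContDiffAt ℝ 1 (fun y => (Thrombus.strain (S.F t y)).trace) x :=
    contDiffAt_trace_strain fun i j => (hR.F ht hx i j).of_le (by norm_num)
  exact ((((contDiffAt_const.mul h1).add (hR.p_smooth t ht x hx)).add
    (contDiffAt_const.mul h2)).add (contDiffAt_const.mul h3)).add
      (contDiffAt_const.mul (h4.mul h5))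

theorem flux_transport : ContDiffAt ℝ 1 (fun y => (-1 * Thrombus.head P S t y) • S.u t y) x :=
  (contDiffAt_const.mul (hR.head hP ht hx)).smul ((hR.u ht hx).of_le (by norm_num))

omit hP in
theorem flux_phase : ContDiffAt ℝ 1
    (fun y => (P.lam * deriv (fun s => S.φ s y) t) • gradient (S.φ t) y) x :=
  (contDiffAt_const.mul ((hR.deriv_φ ht hx).of_le (by norm_num))).smul
    (contDiffAt_gradient (hR.φ ht hx) (by norm_num))

theorem flux_chemPot : ContDiffAt ℝ 1
    (fun y => (P.τ * Thrombus.chemPot P S t y) • gradient (Thrombus.chemPot P S t) y) x :=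
  (contDiffAt_const.mul ((hR.chemPot ht hx hP).of_le (by norm_num))).smul
    (contDiffAt_gradient (hR.chemPot ht hx hP) (by norm_num))

theorem coeff_elastic (a b : Fin d) : ContDiffAt ℝ 1
    (fun y => P.k * P.ν (S.φ t y) ^ 2 * S.F t y a b) x :=
  ((contDiffAt_const.mul ((hR.ν_φ ht hx hP).pow 2)).mul (hR.F ht hx a b)).of_le (by norm_num)

theorem flux_elastic (a b : Fin d) : ContDiffAt ℝ 1
    (fun y => (P.k * P.ν (S.φ t y) ^ 2 * S.F t y a b) • gradient (fun y => S.F t y a b) y) x :=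
  (hR.coeff_elastic hP ht hx a b).smul (contDiffAt_gradient (hR.F ht hx a b) (by norm_num))

theorem flux_stress : ContDiffAt ℝ 1
    (fun y => (WithLp.toLp 2 (fun j => ∑ i, S.u t y i * Thrombus.stress P S t y i j) :
      Space d)) x :=
  contDiffAt_euclidean.2 fun j => ContDiffAt.sum (s := Finset.univ) fun i _ =>
    ((hR.u_apply ht hx i).of_le (by norm_num)).mul (hR.stress hP ht hx i j)

theorem energyFlux : ContDiffAt ℝ 1 (energyFlux P S t) x :=
  ((((hR.flux_transport hP ht hx).add (hR.flux_phase ht hx)).add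
    (hR.flux_chemPot hP ht hx)).add (ContDiffAt.sum fun a _ => ContDiffAt.sum fun b _ =>
      hR.flux_elastic hP ht hx a b)).add (hR.flux_stress hP ht hx)

end IsRegular

/-- The transport and stress terms vanish with `u`; the others are multiples of gradients of `φ`,
`μ` and the entries of `F`, which have no normal component. -/
theorem inner_energyFlux_eq_zero (hS : IsSmoothSolution P Ω T S) (ht : t ∈ Ioo 0 T)
    (hx : x ∈ frontier Ω) {n : Space d} (hn : IsOutwardUnitNormal Ω x n) :
    inner ℝ n (energyFlux P S t x) = 0 := by
  have h0 := hS.u_boundary t ht x hx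
  have h1 : inner ℝ n (gradient (S.φ t) x) = 0 := by
    simpa [inner_gradient_right] using hS.φ_boundary t ht x hx n hn
  have h2 : inner ℝ n (gradient (chemPot P S t) x) = 0 := by
    simpa [inner_gradient_right] using hS.μ_boundary t ht x hx n hn
  have h3 : ∀ a b, inner ℝ n (gradient (fun y => S.F t y a b) x) = 0 := fun a b => by
    simpa [inner_gradient_right] using hS.F_boundary t ht a b x hx n hn
  have h4 : (WithLp.toLp 2 (fun j => ∑ i, S.u t x i * stress P S t x i j) : Space d) = 0 := by
    ext j
    simp [h0]
  rw [energyFlux, h4]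
  simp [inner_add_right, inner_sum, inner_smul_right, h0, h1, h2, h3]

/-- The elastic summand is grouped so that `P.k * (...)` is the diffusion term of the deformation
equation, tested with `ν F`; that equation can then be substituted directly. -/
theorem vdiv_energyFlux (hR : IsRegular Ω T S) (hP : P.Admissible) (ht : t ∈ Ioo 0 T)
    (hx : x ∈ closure Ω) (hdiv : vdiv (S.u t) x = 0) :
    vdiv (energyFlux P S t) x = -adv (S.u t x) (head P S t) x
      + (P.lam * deriv (fun s => S.φ s x) t * lap (S.φ t) x
        + P.lam * ∑ j, pd j (fun y => deriv (fun s => S.φ s y) t) x * pd j (S.φ t) x)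
      + (P.τ * chemPot P S t x * lap (chemPot P S t) x
        + P.τ * ∑ j, pd j (chemPot P S t) x ^ 2)
      + ∑ a, ∑ b, (P.k * (P.ν (S.φ t x) ^ 2 * ∑ j, pd j (fun y => S.F t y a b) x ^ 2)
        + P.ν (S.φ t x) * (S.F t x a b * (P.k * (P.ν (S.φ t x) * lap (fun y => S.F t y a b) x
            + 2 * ∑ l, pd l (fun y => P.ν (S.φ t y)) x * pd l (fun y => S.F t y a b) x))))
      + (∑ i, S.u t x i * mdiv (stress P S t) i x
        + ∑ i, ∑ j, jac (S.u t) x i j * stress P S t x i j) := by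
  have d1 := (hR.flux_transport hP ht hx).differentiableAt one_ne_zero
  have d2 := (hR.flux_phase (P := P) ht hx).differentiableAt one_ne_zero
  have d3 := (hR.flux_chemPot hP ht hx).differentiableAt one_ne_zero
  have d4 := fun a b => (hR.flux_elastic hP ht hx a b).differentiableAt one_ne_zero
  have d4' := fun a => DifferentiableAt.fun_sum (u := Finset.univ) fun b _ => d4 a b
  have d4'' := DifferentiableAt.fun_sum (u := Finset.univ) fun a _ => d4' a
  have d5 := (hR.flux_stress hP ht hx).differentiableAt one_ne_zero
  have du : DifferentiableAt ℝ (S.u t) x := (hR.u ht hx).differentiableAt two_ne_zero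
  have dh := (hR.head hP ht hx).differentiableAt one_ne_zero
  have dφt := (hR.deriv_φ ht hx).differentiableAt three_ne_zero
  have dμ := (hR.chemPot ht hx hP).differentiableAt two_ne_zero
  have dν := (hR.ν_φ ht hx hP).differentiableAt three_ne_zero
  have dF := fun a b => (hR.F ht hx a b).differentiableAt three_ne_zero
  have hpc : ∀ (c : ℝ) (g : Space d → ℝ) (j : Fin d), DifferentiableAt ℝ g x →
      pd j (fun y => c * g y) x = c * pd j g x := fun c g j hg => by
    simp [pd, fderiv_const_mul hg]
  have e1 : vdiv (fun y => (-1 * head P S t y) • S.u t y) x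
      = -adv (S.u t x) (head P S t) x := by
    rw [vdiv_smul (dh.const_mul (-1)) du, hdiv, ← adv_eq_fderiv, adv_const_mul _ dh]
    ring
  have e2 : vdiv (fun y => (P.lam * deriv (fun s => S.φ s y) t) • gradient (S.φ t) y) x
      = P.lam * deriv (fun s => S.φ s x) t * lap (S.φ t) x
        + P.lam * ∑ j, pd j (fun y => deriv (fun s => S.φ s y) t) x * pd j (S.φ t) x := by
    rw [vdiv_smul_gradient (dφt.const_mul _) ((hR.φ ht hx).of_le (by norm_num))]
    simp only [fun j => hpc P.lam _ j dφt, Finset.mul_sum, mul_assoc]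
  have e3 : vdiv (fun y => (P.τ * chemPot P S t y) • gradient (chemPot P S t) y) x
      = P.τ * chemPot P S t x * lap (chemPot P S t) x
        + P.τ * ∑ j, pd j (chemPot P S t) x ^ 2 := by
    rw [vdiv_smul_gradient (dμ.const_mul _) (hR.chemPot ht hx hP)]
    simp only [fun j => hpc P.τ _ j dμ, Finset.mul_sum, mul_assoc, pow_two]
  have e4 : ∀ a b, vdiv (fun y => (P.k * P.ν (S.φ t y) ^ 2 * S.F t y a b) •
      gradient (fun y => S.F t y a b) y) x
      = P.k * (P.ν (S.φ t x) ^ 2 * ∑ j, pd j (fun y => S.F t y a b) x ^ 2)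
        + P.ν (S.φ t x) * (S.F t x a b * (P.k * (P.ν (S.φ t x) * lap (fun y => S.F t y a b) x
            + 2 * ∑ l, pd l (fun y => P.ν (S.φ t y)) x * pd l (fun y => S.F t y a b) x))) := by
    intro a b
    rw [vdiv_smul_gradient ((hR.coeff_elastic hP ht hx a b).differentiableAt one_ne_zero)
      ((hR.F ht hx a b).of_le (by norm_num))]
    -- The term with `2 ν ∂ⱼν` comes from the weight `ν²`; it yields the `2 ∇ν·∇F` of the diffusion
    -- operator.
    have h1 : ∀ j, pd j (fun y => P.k * P.ν (S.φ t y) ^ 2 * S.F t y a b) x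
        = P.k * (P.ν (S.φ t x) ^ 2 * pd j (fun y => S.F t y a b) x
          + 2 * P.ν (S.φ t x) * S.F t x a b * pd j (fun y => P.ν (S.φ t y)) x) := by
      intro j
      have h2 : pd j (fun y => P.ν (S.φ t y) * P.ν (S.φ t y)) x = _ := pd_mul j dν dν
      simp only [pow_two]
      rw [pd_mul j ((dν.fun_mul dν).const_mul P.k) (dF a b), hpc _ _ j (dν.fun_mul dν), h2]
      ring
    have h3 : ∑ j, pd j (fun y => P.k * P.ν (S.φ t y) ^ 2 * S.F t y a b) x *
        pd j (fun y => S.F t y a b) x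
        = P.k * P.ν (S.φ t x) ^ 2 * (∑ j, pd j (fun y => S.F t y a b) x ^ 2)
          + 2 * P.k * P.ν (S.φ t x) * S.F t x a b *
            ∑ l, pd l (fun y => P.ν (S.φ t y)) x * pd l (fun y => S.F t y a b) x := by
      rw [Finset.mul_sum, Finset.mul_sum, ← Finset.sum_add_distrib]
      refine Finset.sum_congr rfl fun j _ => ?_
      rw [h1]
      ring
    rw [h3]
    ring
  have e5 := vdiv_vecMul (M := stress P S t) du
    fun i j => (hR.stress hP ht hx i j).differentiableAt one_ne_zero
  have e4' : vdiv (fun y => ∑ a, ∑ b, (P.k * P.ν (S.φ t y) ^ 2 * S.F t y a b) •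
      gradient (fun y => S.F t y a b) y) x = _ := vdiv_sum fun a _ => d4' a
  have e4'' : ∀ a, vdiv (fun y => ∑ b, (P.k * P.ν (S.φ t y) ^ 2 * S.F t y a b) •
      gradient (fun y => S.F t y a b) y) x = _ := fun a => vdiv_sum fun b _ => d4 a b
  have key : vdiv (energyFlux P S t) x = _ :=
    vdiv_add (((d1.fun_add d2).fun_add d3).fun_add d4'') d5
  rw [key, vdiv_add ((d1.fun_add d2).fun_add d3) d4'', vdiv_add (d1.fun_add d2) d3,
    vdiv_add d1 d2, e1, e2, e3, e4', e5]
  simp only [e4'', e4]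

/-- The chain rule leaves `v · ∇φ` with the coefficients `λ γ f'` and `ν'/2 · tr(F Fᵀ - I)`, the
zeroth-order part of `μ`. -/
theorem adv_head (hR : IsRegular Ω T S) (hP : P.Admissible) (ht : t ∈ Ioo 0 T)
    (hx : x ∈ closure Ω) (v : Space d) :
    adv v (head P S t) x = P.ρ * ∑ i, S.u t x i * adv v (fun y => S.u t y i) x
      + adv v (S.p t) x + P.lam / 2 * adv v (fun y => ∑ j, pd j (S.φ t) y ^ 2) x
      + P.lam * P.γ * (deriv P.f (S.φ t x) * adv v (S.φ t) x)
      + (1 / 2 * (deriv P.ν (S.φ t x) * adv v (S.φ t) x * (strain (S.F t x)).trace)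
        + P.ν (S.φ t x) * ∑ a, ∑ b, S.F t x a b * adv v (fun y => S.F t y a b) x) := by
  have du := fun i => (hR.u_apply ht hx i).differentiableAt two_ne_zero
  have dp := (hR.p_smooth t ht x hx).differentiableAt one_ne_zero
  have dφ := (hR.φ ht hx).differentiableAt four_ne_zero
  have dF := fun a b => (hR.F ht hx a b).differentiableAt three_ne_zero
  have dν := (hR.ν_φ ht hx hP).differentiableAt three_ne_zero
  have df := (hR.f_φ (P := P) ht hx).differentiableAt four_ne_zero
  have dpd := fun j => (contDiffAt_pd j (hR.φ ht hx) (m := 1) (by norm_num)).differentiableAt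
    one_ne_zero
  have du2 := DifferentiableAt.fun_sum (u := Finset.univ) fun i _ => (du i).fun_pow 2
  have dpd2 := DifferentiableAt.fun_sum (u := Finset.univ) fun j _ => (dpd j).fun_pow 2
  have dF2' := fun a => DifferentiableAt.fun_sum (u := Finset.univ) fun b _ => (dF a b).fun_pow 2
  have dF2 := DifferentiableAt.fun_sum (u := Finset.univ) fun a _ => dF2' a
  have dtr := dF2.sub_const (d : ℝ)
  have eu : adv v (fun y => ∑ i, S.u t y i ^ 2) x
      = 2 * ∑ i, S.u t x i * adv v (fun y => S.u t y i) x := by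
    rw [adv_sum fun i _ => (du i).fun_pow 2, Finset.mul_sum]
    exact Finset.sum_congr rfl fun i _ => adv_sq (du i)
  have etr : adv v (fun y => (∑ a, ∑ b, S.F t y a b ^ 2) - (d : ℝ)) x
      = 2 * ∑ a, ∑ b, S.F t x a b * adv v (fun y => S.F t y a b) x := by
    rw [adv_sub_const, adv_sum fun a _ => dF2' a, Finset.mul_sum]
    refine Finset.sum_congr rfl fun a _ => ?_
    rw [adv_sum fun b _ => (dF a b).fun_pow 2, Finset.mul_sum]
    exact Finset.sum_congr rfl fun b _ => adv_sq (dF a b)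
  have eν : adv v (fun y => P.ν (S.φ t y)) x = deriv P.ν (S.φ t x) * adv v (S.φ t) x :=
    adv_comp (hP.ν_contDiff.differentiable three_ne_zero _) dφ
  have ef : adv v (fun y => P.f (S.φ t y)) x = deriv P.f (S.φ t x) * adv v (S.φ t) x :=
    adv_comp ((P.contDiff_f (n := 1)).differentiable one_ne_zero _) dφ
  have hh : head P S t = fun y => P.ρ / 2 * (∑ i, S.u t y i ^ 2) + S.p t y
      + P.lam / 2 * (∑ j, pd j (S.φ t) y ^ 2) + P.lam * P.γ * P.f (S.φ t y)
      + 1 / 2 * (P.ν (S.φ t y) * ((∑ a, ∑ b, S.F t y a b ^ 2) - (d : ℝ))) :=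
    funext fun y => by rw [head, trace_strain]
  have d1 := du2.const_mul (P.ρ / 2)
  have d2 := d1.fun_add dp
  have d3 := d2.fun_add (dpd2.const_mul (P.lam / 2))
  have d4 := d3.fun_add (df.const_mul (P.lam * P.γ))
  rw [hh, adv_add d4 ((dν.fun_mul dtr).const_mul _), adv_add d3 (df.const_mul _),
    adv_add d2 (dpd2.const_mul _), adv_add d1 dp, adv_const_mul _ du2, adv_const_mul _ dpd2,
    adv_const_mul _ df, adv_const_mul _ (dν.fun_mul dtr), adv_mul dν dtr, eu, etr, eν, ef,
    trace_strain]
  ring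

theorem energyDensity_eq (P : Params) (S : Fields d) (t : ℝ) (x : Space d) :
    energyDensity P S t x = P.ρ * (∑ i, S.u t x i ^ 2) + P.lam * (∑ j, pd j (S.φ t) x ^ 2)
      + 2 * P.lam * P.γ * P.f (S.φ t x)
      + P.ν (S.φ t x) * ((∑ a, ∑ b, S.F t x a b ^ 2) - d) := by
  rw [energyDensity, EuclideanSpace.real_norm_sq_eq, norm_sq_gradient, trace_strain]

theorem IsRegular.energyDensity (hR : IsRegular Ω T S) (hP : P.Admissible) (ht : t ∈ Ioo 0 T)
    (hx : x ∈ closure Ω) :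
    ContDiffAt ℝ 1 (fun z : ℝ × Space d => energyDensity P S z.1 z.2) (t, x) := by
  have hφ := (hR.φ_smooth t ht x hx).of_le (by norm_num : (1 : WithTop ℕ∞) ≤ 4)
  have h1 : ContDiffAt ℝ 1 (fun z : ℝ × Space d => ∑ i, S.u z.1 z.2 i ^ 2) (t, x) :=
    ContDiffAt.sum fun i _ => ((hR.u_joint_apply ht hx i).of_le (by norm_num)).pow 2
  have h2 : ContDiffAt ℝ 1 (fun z : ℝ × Space d => ∑ j, pd j (S.φ z.1) z.2 ^ 2) (t, x) :=
    ContDiffAt.sum fun j _ =>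
      (contDiffAt_pd_joint j (hR.φ_smooth t ht x hx) (by norm_num)).pow 2
  have h3 : ContDiffAt ℝ 1 (fun z : ℝ × Space d => P.f (S.φ z.1 z.2)) (t, x) :=
    P.contDiff_f.contDiffAt.comp (t, x) hφ
  have h4 : ContDiffAt ℝ 1 (fun z : ℝ × Space d => P.ν (S.φ z.1 z.2)) (t, x) :=
    (hP.ν_contDiff.of_le (by norm_num)).contDiffAt.comp (t, x) hφ
  have h5 : ContDiffAt ℝ 1
      (fun z : ℝ × Space d => (∑ a, ∑ b, S.F z.1 z.2 a b ^ 2) - (d : ℝ)) (t, x) :=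
    (ContDiffAt.sum fun a _ => ContDiffAt.sum fun b _ =>
      ((hR.F_smooth t ht x hx a b).of_le (by norm_num)).pow 2).sub contDiffAt_const
  simp only [energyDensity_eq]
  exact (((contDiffAt_const.mul h1).add (contDiffAt_const.mul h2)).add
    (contDiffAt_const.mul h3)).add (h4.mul h5)

/-- The time derivative is moved inside `∇φ` to match the term `λ ∇(∂ₜφ)·∇φ` in the divergence of
the flux. -/
theorem deriv_energyDensity (hR : IsRegular Ω T S) (hP : P.Admissible) (ht : t ∈ Ioo 0 T)
    (hx : x ∈ closure Ω) :
    deriv (fun s => energyDensity P S s x) t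
      = 2 * (P.ρ * ∑ i, S.u t x i * deriv (fun s => S.u s x i) t
        + P.lam * ∑ j, pd j (fun y => deriv (fun s => S.φ s y) t) x * pd j (S.φ t) x
        + P.lam * P.γ * (deriv P.f (S.φ t x) * deriv (fun s => S.φ s x) t)
        + 1 / 2 * (deriv P.ν (S.φ t x) * deriv (fun s => S.φ s x) t * (strain (S.F t x)).trace)
        + P.ν (S.φ t x) * ∑ a, ∑ b, S.F t x a b * deriv (fun s => S.F s x a b) t) := by
  have hu : ∀ i, HasDerivAt (fun s => S.u s x i) (deriv (fun s => S.u s x i) t) t := fun i =>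
    (hasDerivAt_slice (g := fun s y => S.u s y i)
      ((hR.u_joint_apply ht hx i).differentiableAt two_ne_zero)).differentiableAt.hasDerivAt
  have hφ : HasDerivAt (fun s => S.φ s x) (deriv (fun s => S.φ s x) t) t :=
    (hasDerivAt_slice
      ((hR.φ_smooth t ht x hx).differentiableAt four_ne_zero)).differentiableAt.hasDerivAt
  have hF : ∀ a b, HasDerivAt (fun s => S.F s x a b) (deriv (fun s => S.F s x a b) t) t :=
    fun a b => (hasDerivAt_slice (g := fun s y => S.F s y a b)
      ((hR.F_smooth t ht x hx a b).differentiableAt three_ne_zero)).differentiableAt.hasDerivAt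
  have hg : ∀ j, HasDerivAt (fun s => pd j (S.φ s) x)
      (pd j (fun y => deriv (fun s => S.φ s y) t) x) t := fun j => by
    rw [← deriv_pd_comm j ((hR.φ_smooth t ht x hx).of_le (by norm_num))]
    exact (hasDerivAt_slice (g := fun s y => pd j (S.φ s) y)
      ((contDiffAt_pd_joint j (hR.φ_smooth t ht x hx) (m := 1) (by norm_num)).differentiableAt
        one_ne_zero)).differentiableAt.hasDerivAt
  have hf : HasDerivAt (fun s => P.f (S.φ s x)) _ t :=
    ((P.contDiff_f (n := 1)).differentiable one_ne_zero _).hasDerivAt.comp t hφ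
  have hν : HasDerivAt (fun s => P.ν (S.φ s x)) _ t :=
    (hP.ν_contDiff.differentiable three_ne_zero _).hasDerivAt.comp t hφ
  have h1 := HasDerivAt.fun_sum (u := Finset.univ) fun i _ => (hu i).fun_pow 2
  have h2 := HasDerivAt.fun_sum (u := Finset.univ) fun j _ => (hg j).fun_pow 2
  have h3 := (HasDerivAt.fun_sum (u := Finset.univ) fun a _ =>
    HasDerivAt.fun_sum (u := Finset.univ) fun b _ => (hF a b).fun_pow 2).sub_const (d : ℝ)
  have h := (((h1.const_mul P.ρ).fun_add (h2.const_mul P.lam)).fun_add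
    (hf.const_mul (2 * P.lam * P.γ))).fun_add (hν.fun_mul h3)
  simp only [energyDensity_eq]
  rw [h.deriv, trace_strain]
  have s1 : ∑ i, (2 : ℕ) * S.u t x i ^ (2 - 1) * deriv (fun s => S.u s x i) t
      = 2 * ∑ i, S.u t x i * deriv (fun s => S.u s x i) t := by
    rw [Finset.mul_sum]
    exact Finset.sum_congr rfl fun i _ => by push_cast; ring
  have s2 : ∑ j, (2 : ℕ) * pd j (S.φ t) x ^ (2 - 1) * pd j (fun y => deriv (fun s => S.φ s y) t) x
      = 2 * ∑ j, pd j (fun y => deriv (fun s => S.φ s y) t) x * pd j (S.φ t) x := by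
    rw [Finset.mul_sum]
    exact Finset.sum_congr rfl fun i _ => by push_cast; ring
  have s3 : ∑ a, ∑ b, (2 : ℕ) * S.F t x a b ^ (2 - 1) * deriv (fun s => S.F s x a b) t
      = 2 * ∑ a, ∑ b, S.F t x a b * deriv (fun s => S.F s x a b) t := by
    simp only [Finset.mul_sum]
    exact Finset.sum_congr rfl fun a _ => Finset.sum_congr rfl fun b _ => by push_cast; ring
  rw [s1, s2, s3]
  ring

/-- The local energy balance. -/
theorem half_deriv_energyDensity (hS : IsSmoothSolution P Ω T S) (hP : P.Admissible)
    (ht : t ∈ Ioo 0 T) (hx : x ∈ Ω) :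
    1 / 2 * deriv (fun s => energyDensity P S s x) t = vdiv (energyFlux P S t) x
      - ((P.η (S.φ t x) * (∑ i, ∑ j, jac (S.u t) x i j ^ 2)
          + P.τ * ‖gradient (chemPot P S t) x‖ ^ 2)
        + P.k * (P.ν (S.φ t x) ^ 2 * ∑ i, ∑ j, ‖gradient (fun y => S.F t y i j) x‖ ^ 2)
        + P.η (S.φ t x) / P.κ (S.φ t x) * (1 - S.φ t x) * ‖S.u t x‖ ^ 2) := by
  have hR := hS.regular
  have hxc := subset_closure hx
  have hdiv := hS.incompressible t ht x hx
  have hmdiv : ∀ i, mdiv (stress P S t) i x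
      = mdiv (fun y => P.η (S.φ t y) • jac (S.u t) y) i x
        + mdiv (fun y => P.ν (S.φ t y) • strain (S.F t y)) i x := fun i =>
    mdiv_add i
      (fun a b => ((hR.η_φ ht hxc hP).mul (hR.jac ht hxc a b)).differentiableAt one_ne_zero)
      (fun a b => ((hR.ν_φ ht hxc hP).mul (hR.strain ht hxc a b)).differentiableAt three_ne_zero)
  -- The momentum equation tested with `u`, with viscous and elastic stresses merged.
  have hmom : P.ρ * (∑ i, S.u t x i * deriv (fun s => S.u s x i) t
        + ∑ i, S.u t x i * adv (S.u t x) (fun y => S.u t y i) x) + adv (S.u t x) (S.p t) x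
      = -P.lam * (∑ i, S.u t x i *
          mdiv (fun y => Matrix.of fun a b => pd a (S.φ t) y * pd b (S.φ t) y) i x)
        + ∑ i, S.u t x i * mdiv (stress P S t) i x
        - P.η (S.φ t x) / P.κ (S.φ t x) * (1 - S.φ t x) * ∑ i, S.u t x i ^ 2 := by
    simp only [adv, Finset.mul_sum, ← Finset.sum_add_distrib, ← Finset.sum_sub_distrib]
    refine Finset.sum_congr rfl fun i _ => ?_
    have := hS.momentum t ht x hx i
    simp only [adv] at this
    rw [← Finset.mul_sum, hmdiv]
    linear_combination S.u t x i * this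
  have hstress : ∑ i, ∑ j, jac (S.u t) x i j * stress P S t x i j
      = P.η (S.φ t x) * (∑ i, ∑ j, jac (S.u t) x i j ^ 2)
        + P.ν (S.φ t x) * ∑ i, ∑ j, S.F t x i j * (jac (S.u t) x * S.F t x) i j := by
    -- Incompressibility enters here as tracelessness of `∇u`.
    rw [sum_mul_mul_eq_sum_mul_strain (S.F t x) (jac (S.u t) x) hdiv]
    simp only [Finset.mul_sum, ← Finset.sum_add_distrib]
    refine Finset.sum_congr rfl fun i _ => Finset.sum_congr rfl fun j _ => ?_
    simp only [stress, Matrix.add_apply, Matrix.smul_apply, smul_eq_mul]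
    ring
  have hel : ∑ a, ∑ b, (P.k * (P.ν (S.φ t x) ^ 2 * ∑ j, pd j (fun y => S.F t y a b) x ^ 2)
        + P.ν (S.φ t x) * (S.F t x a b * (P.k * (P.ν (S.φ t x) * lap (fun y => S.F t y a b) x
            + 2 * ∑ l, pd l (fun y => P.ν (S.φ t y)) x * pd l (fun y => S.F t y a b) x))))
      = P.k * (P.ν (S.φ t x) ^ 2 * ∑ a, ∑ b, ∑ j, pd j (fun y => S.F t y a b) x ^ 2)
        + P.ν (S.φ t x) * (∑ a, ∑ b, S.F t x a b * deriv (fun s => S.F s x a b) t)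
        + P.ν (S.φ t x) * (∑ a, ∑ b, S.F t x a b * adv (S.u t x) (fun y => S.F t y a b) x)
        - P.ν (S.φ t x) * ∑ a, ∑ b, S.F t x a b * (jac (S.u t) x * S.F t x) a b := by
    have h : ∀ a b, P.k * (P.ν (S.φ t x) * lap (fun y => S.F t y a b) x
            + 2 * ∑ l, pd l (fun y => P.ν (S.φ t y)) x * pd l (fun y => S.F t y a b) x)
        = deriv (fun s => S.F s x a b) t + adv (S.u t x) (fun y => S.F t y a b) x
          - (jac (S.u t) x * S.F t x) a b := fun a b => by
      linear_combination -(hS.deformation t ht x hx a b)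
    simp only [h, mul_sub, mul_add, Finset.sum_add_distrib, Finset.sum_sub_distrib,
      ← Finset.mul_sum]
    ring
  rw [deriv_energyDensity hR hP ht hxc, vdiv_energyFlux hR hP ht hxc hdiv,
    adv_head hR hP ht hxc, hstress, hel, norm_sq_gradient, EuclideanSpace.real_norm_sq_eq]
  simp only [norm_sq_gradient]
  rw [sum_mul_mdiv_gradient_tensor ((hR.φ ht hxc).of_le (by norm_num))] at hmom
  have hφ := hS.phase t ht x hx
  have hμ : chemPot P S t x = -P.lam * lap (S.φ t) x + P.lam * P.γ * deriv P.f (S.φ t x)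
    + deriv P.ν (S.φ t x) / 2 * (strain (S.F t x)).trace := rfl
  generalize chemPot P S t x = μ at *
  -- The phase equation is tested with `μ`, and the definition of `μ` with `∂ₜφ + u·∇φ`.
  linear_combination hmom + μ * hφ
    - (deriv (fun s => S.φ s x) t + adv (S.u t x) (S.φ t) x) * hμ

/-! ### The energy law -/

/-- All densities are continuous on the compact closure, since `κ` is bounded away from zero.
Integrability is recorded as well because separating off the flux under the integral requires it. -/
theorem integral_dissipationDensity (hR : IsRegular Ω T S) (hP : P.Admissible)
    (hb : Bornology.IsBounded Ω) (ht : t ∈ Ioo 0 T) :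
    IntegrableOn (fun x => (P.η (S.φ t x) * (∑ i, ∑ j, jac (S.u t) x i j ^ 2)
          + P.τ * ‖gradient (chemPot P S t) x‖ ^ 2)
        + P.k * (P.ν (S.φ t x) ^ 2 * ∑ i, ∑ j, ‖gradient (fun y => S.F t y i j) x‖ ^ 2)
        + P.η (S.φ t x) / P.κ (S.φ t x) * (1 - S.φ t x) * ‖S.u t x‖ ^ 2) Ω ∧
    ∫ x in Ω, ((P.η (S.φ t x) * (∑ i, ∑ j, jac (S.u t) x i j ^ 2)
          + P.τ * ‖gradient (chemPot P S t) x‖ ^ 2)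
        + P.k * (P.ν (S.φ t x) ^ 2 * ∑ i, ∑ j, ‖gradient (fun y => S.F t y i j) x‖ ^ 2)
        + P.η (S.φ t x) / P.κ (S.φ t x) * (1 - S.φ t x) * ‖S.u t x‖ ^ 2)
      = dissipation P Ω S t := by
  have hint : ∀ f : Space d → ℝ, (∀ x ∈ closure Ω, ContinuousAt f x) → IntegrableOn f Ω :=
    fun f hf => (ContinuousOn.integrableOn_compact hb.isCompact_closure fun x hx =>
      (hf x hx).continuousWithinAt).mono_set subset_closure
  have hκ : ∀ s, P.κ s ≠ 0 := fun s => by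
    obtain ⟨α, β, hα, h⟩ := hP.bounds
    exact (hα.trans_le (h s).2.2.1).ne'
  have h1 : IntegrableOn (fun x => P.η (S.φ t x) * (∑ i, ∑ j, jac (S.u t) x i j ^ 2)
      + P.τ * ‖gradient (chemPot P S t) x‖ ^ 2) Ω := hint _ fun x hx => by
    have a1 := (hR.η_φ ht hx hP).continuousAt
    have a2 := fun i j => (hR.jac ht hx i j).continuousAt
    have a3 := (contDiffAt_gradient (hR.chemPot ht hx hP) (m := 1) (by norm_num)).continuousAt
    exact (a1.mul (tendsto_finsetSum _ fun i _ => tendsto_finsetSum _ fun j _ =>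
      (a2 i j).pow 2)).add (continuousAt_const.mul (a3.norm.pow 2))
  have h2 : IntegrableOn (fun x => P.ν (S.φ t x) ^ 2 *
      ∑ i, ∑ j, ‖gradient (fun y => S.F t y i j) x‖ ^ 2) Ω := hint _ fun x hx => by
    have a1 := (hR.ν_φ ht hx hP).continuousAt
    have a2 := fun i j =>
      (contDiffAt_gradient (hR.F ht hx i j) (m := 1) (by norm_num)).continuousAt
    exact (a1.pow 2).mul (tendsto_finsetSum _ fun i _ => tendsto_finsetSum _ fun j _ =>
      (a2 i j).norm.pow 2)
  have h3 : IntegrableOn (fun x => P.η (S.φ t x) / P.κ (S.φ t x) * (1 - S.φ t x) *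
      ‖S.u t x‖ ^ 2) Ω := hint _ fun x hx => by
    have a1 := (hR.η_φ ht hx hP).continuousAt
    have a2 := (hR.φ ht hx).continuousAt
    have a3 : ContinuousAt (fun y => P.κ (S.φ t y)) x :=
      hP.κ_contDiff.continuous.continuousAt.comp a2
    have a4 := (hR.u ht hx).continuousAt
    exact ((a1.div a3 (hκ _)).mul (continuousAt_const.sub a2)).mul (a4.norm.pow 2)
  have h2' := h2.const_mul P.k
  refine ⟨(h1.add h2').add h3, ?_⟩
  have e1 := integral_add (h1.add h2') h3
  have e2 := integral_add h1 h2'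
  simp only [Pi.add_apply] at e1 e2
  rw [e1, e2, integral_const_mul]
  rfl

theorem hasDerivAt_half_totalEnergy (hΩ : IsOpen Ω) (hb : Bornology.IsBounded Ω)
    (hbd : HasC2Boundary Ω) (hP : P.Admissible) (hS : IsSmoothSolution P Ω T S)
    (ht : t ∈ Ioo 0 T) :
    HasDerivAt (fun s => (1 / 2 : ℝ) * totalEnergy P Ω S s) (-dissipation P Ω S t) t := by
  have hR := hS.regular
  have hE : HasDerivAt (totalEnergy P Ω S)
      (∫ x in Ω, deriv (fun s => energyDensity P S s x) t) t :=
    hasDerivAt_integral_of_contDiffAt hΩ hb ht (e := fun z => energyDensity P S z.1 z.2)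
      fun s hs x hx => hR.energyDensity hP hs hx
  obtain ⟨hDi, hD⟩ := integral_dissipationDensity hR hP hb ht
  have hflux : ∀ x ∈ closure Ω, ContDiffAt ℝ 1 (energyFlux P S t) x := fun x hx =>
    hR.energyFlux hP ht hx
  have hdivi : IntegrableOn (vdiv (energyFlux P S t)) Ω :=
    (ContinuousOn.integrableOn_compact hb.isCompact_closure fun x hx =>
      (continuousAt_vdiv (hflux x hx)).continuousWithinAt).mono_set subset_closure
  have hval : 1 / 2 * ∫ x in Ω, deriv (fun s => energyDensity P S s x) t
      = -dissipation P Ω S t := by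
    rw [← integral_const_mul, setIntegral_congr_fun hΩ.measurableSet fun x hx =>
      half_deriv_energyDensity hS hP ht hx, integral_sub hdivi hDi, hD,
      integral_vdiv_eq_zero hΩ hb hbd hflux fun x hx n hn => inner_energyFlux_eq_zero hS ht hx hn,
      zero_sub]
  rw [← hval]
  exact hE.const_mul (1 / 2 : ℝ)

theorem dissipation_nonneg (hΩ : IsOpen Ω) (hP : P.Admissible) (h : ∀ x ∈ Ω, S.φ t x ≤ 1) :
    0 ≤ dissipation P Ω S t := by
  obtain ⟨α, β, hα, hbd⟩ := hP.bounds
  have hη : ∀ s, 0 ≤ P.η s := fun s => hα.le.trans (hbd s).1.1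
  have hκ : ∀ s, 0 ≤ P.κ s := fun s => hα.le.trans (hbd s).2.2.1
  have hτ := hP.τ_pos.le
  have hk := hP.k_pos.le
  refine add_nonneg (add_nonneg ?_ (mul_nonneg hk ?_)) ?_
  · exact integral_nonneg fun x => add_nonneg
      (mul_nonneg (hη _) (Finset.sum_nonneg fun i _ => Finset.sum_nonneg fun j _ => sq_nonneg _))
      (mul_nonneg hτ (sq_nonneg _))
  · exact integral_nonneg fun x => mul_nonneg (sq_nonneg _)
      (Finset.sum_nonneg fun i _ => Finset.sum_nonneg fun j _ => sq_nonneg _)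
  -- The only term whose sign depends on `φ ≤ 1`, which is known on `Ω` alone; hence the argument on
  -- the set.
  · exact setIntegral_nonneg hΩ.measurableSet fun x hx => mul_nonneg
      (mul_nonneg (div_nonneg (hη _) (hκ _)) (sub_nonneg.2 (h x hx))) (sq_nonneg _)

theorem continuousOn_totalEnergy (hΩ : IsOpen Ω) (hb : Bornology.IsBounded Ω)
    (hP : P.Admissible) (hR : IsRegular Ω T S) :
    ContinuousOn (totalEnergy P Ω S) (Icc 0 T) := by
  refine continuousOn_integral_of_bounded hΩ hb (e := fun z => energyDensity P S z.1 z.2) ?_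
  have h1 : ContinuousOn (fun z : ℝ × Space d => P.f (S.φ z.1 z.2)) (Icc 0 T ×ˢ closure Ω) :=
    (P.contDiff_f (n := 1)).continuous.comp_continuousOn hR.φ_cont
  have h2 : ContinuousOn (fun z : ℝ × Space d => P.ν (S.φ z.1 z.2)) (Icc 0 T ×ˢ closure Ω) :=
    hP.ν_contDiff.continuous.comp_continuousOn hR.φ_cont
  have h3 : ContinuousOn (fun z : ℝ × Space d => (strain (S.F z.1 z.2)).trace)
      (Icc 0 T ×ˢ closure Ω) := by
    simp only [trace_strain]
    exact (continuousOn_finsetSum _ fun a _ => continuousOn_finsetSum _ fun b _ =>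
      (hR.F_cont a b).pow 2).sub continuousOn_const
  exact (((continuousOn_const.mul (hR.u_cont.norm.pow 2)).add
    (continuousOn_const.mul (hR.gradφ_cont.norm.pow 2))).add (continuousOn_const.mul h1)).add
      (h2.mul h3)

end Thrombus

end

theorem mainTheorem2 (d : ℕ) (Ω : Set (Thrombus.Space d)) (hΩ_open : IsOpen Ω)
    (hΩ_bdd : Bornology.IsBounded Ω) (hΩ_bdry : Thrombus.HasC2Boundary Ω)
    (T : ℝ) (hT : 0 < T) (P : Thrombus.Params) (hP : P.Admissible)
    (S : Thrombus.Fields d) (hS : Thrombus.IsSmoothSolution P Ω T S) :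
    (∀ t ∈ Set.Ioo 0 T,
      HasDerivAt (fun s => (1 / 2 : ℝ) * Thrombus.totalEnergy P Ω S s)
        (-Thrombus.dissipation P Ω S t) t) ∧
    (∀ t ∈ Set.Ioo 0 T, (∀ x ∈ Ω, S.φ t x ≤ 1) → 0 ≤ Thrombus.dissipation P Ω S t) ∧
    ((∀ t ∈ Set.Ioo 0 T, ∀ x ∈ Ω, S.φ t x ≤ 1) →
      AntitoneOn (Thrombus.totalEnergy P Ω S) (Set.Icc 0 T)) := by
  have hder : ∀ t ∈ Set.Ioo 0 T, HasDerivAt (fun s => (1 / 2 : ℝ) * Thrombus.totalEnergy P Ω S s)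
      (-Thrombus.dissipation P Ω S t) t := fun t ht =>
    Thrombus.hasDerivAt_half_totalEnergy hΩ_open hΩ_bdd hΩ_bdry hP hS ht
  refine ⟨hder, fun t _ h => Thrombus.dissipation_nonneg hΩ_open hP h, fun h => ?_⟩
  have hanti : AntitoneOn (fun s => (1 / 2 : ℝ) * Thrombus.totalEnergy P Ω S s)
      (Set.Icc 0 T) := by
    -- The energy law holds on the open interval only; continuity up to `0` and `T` covers the
    -- endpoints.
    refine antitoneOn_of_deriv_nonpos (convex_Icc 0 T) (continuousOn_const.mul
      (Thrombus.continuousOn_totalEnergy hΩ_open hΩ_bdd hP hS.regular)) ?_ ?_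
    · rw [interior_Icc]
      exact fun t ht => (hder t ht).differentiableAt.differentiableWithinAt
    · rw [interior_Icc]
      intro t ht
      rw [(hder t ht).deriv]
      exact neg_nonpos.2 (Thrombus.dissipation_nonneg hΩ_open hP (h t ht))
  intro a ha b hb hab
  have := hanti ha hb hab
  simp only at this
  linarith
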